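/- Let $d\ge 1$. For $z\in\mathbb{Z}^d$ put $\|z\|=\max_i|z_i|$, and for finite nonempty $I,J\subset\mathbb{Z}^d$ put $\operatorname{dist}(I,J)=\min\{\|i-j\|: i\in I,\ j\in J\}$. For $F:\mathbb{R}^n\to\mathbb{R}$ let $\operatorname{Lip}(F)=\sup_{x\ne y}|F(x)-F(y)|/\sum_{i}|x_i-y_i|$. A real random field $X=\{X_j,\ j\in\mathbb{Z}^d\}$ with $\mathbb{E}X_j^2<\infty$ for all $j$ is called $(BL,\theta)$-dependent, where $\theta=(\theta_r)_{r\ge1}$ is a sequence of positive numbers with $\theta_r\to0$, if for all disjoint nonempty finite sets $I,J\subset\mathbb{Z}^d$ and all bounded Lipschitz functions $f:\mathbb{R}^{|I|}\to\mathbb{R}$ and $g:\mathbb{R}^{|J|}\to\mathbb{R}$, with $r=\operatorname{dist}(I,J)$, $$|\operatorname{cov}(f(X_i, i\in I),\,g(X_j, j\in J))|\le \operatorname{Lip}(f)\operatorname{Lip}(g)\min(|I|,|J|)\,\theta_r .$$ A block is a set $(a,b]=\big((a_1,b_1]\times\dots\times(a_d,b_d]\big)\cap\mathbb{Z}^d$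 with $a,b\in\mathbb{Z}^d$ and $a_i<b_i$ for all $i$. For finite $V$ let $S(V)=\sum_{j\in V}X_j$, and for a block $V$ let $M(V)=\max|S(W)|$ over all blocks $W\subseteq V$. For $x>2$ let $$\psi(x)=\begin{cases}(x-1)/(x-2), & 2<x\le4,\\ (3-\sqrt{x})(\sqrt{x}+1)/2, & 4<x\le t_0^2,\\ \big((x-1)\sqrt{(x-2)^2-3}-x^2+6x-11\big)/(3x-12), & x>t_0^2,\end{cases}$$ where $t_0\approx2.1413$ is the maximal root of $t^3+2t^2-7t-4=0$. **Theorem 1.1.** Let $d\ge1$, $p>2$, $D\ge0$, $c_0>1$ and $\lambda>d\,\psi(p)$. There exist $\delta>0$ and $C>1$, depending only on $d,p,D,c_0$ and $\lambda$, such that for every centered $(BL,\theta)$-dependent random field $X$ on $\mathbb{Z}^d$ with $\sup_j\mathbb{E}|X_j|^p\le D$ and $\theta_r\le c_0r^{-\lambda}$ for all integers $r\ge1$, and for every block $U\subset\mathbb{Z}^d$, $$\mathbb{E}|S(U)|^{2+\delta}\le C|U|^{1+\delta/2},\qquad \mathbb{E}M(U)^{2+\delta}\le AC|U|^{1+\delta/2},$$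 where $A=5^d\big(1-2^{-\delta/(4+2\delta)}\big)^{-d(2+\delta)}$. -/

import Mathlib

open MeasureTheory ProbabilityTheory Filter Topology
open scoped ENNReal NNReal

noncomputable section

namespace BLField

/-- The integer lattice of dimension `d`. -/
abbrev Lat (d : ℕ) : Type := Fin d → ℤ

/-- The maximum norm on the lattice, `‖z‖ = max |z_i|`. -/
def supNorm {d : ℕ} (z : Lat d) : ℕ :=
  Finset.univ.sup fun i => (z i).natAbs

/-- The distance `min {‖i - j‖ : i ∈ I, j ∈ J}` between two (nonempty) finite sets. -/
def setDist {d : ℕ} (I J : Finset (Lat d)) : ℕ :=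
  sInf {r : ℕ | ∃ i ∈ I, ∃ j ∈ J, r = supNorm (i - j)}

/-- `F` is Lipschitz (with respect to the `ℓ¹` distance). -/
def IsLip {ι : Type} [Fintype ι] (F : (ι → ℝ) → ℝ) : Prop :=
  ∃ K : ℝ, ∀ x y, |F x - F y| ≤ K * ∑ i, |x i - y i|

/-- `F` is bounded. -/
def IsBdd {ι : Type} (F : (ι → ℝ) → ℝ) : Prop :=
  ∃ B : ℝ, ∀ x, |F x| ≤ B

/-- The Lipschitz constant `sup_{x ≠ y} |F x - F y| / ∑ |x_i - y_i|`.
The diagonal pairs contribute the value `0 / 0 = 0`, which does not change the supremum of these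
nonnegative ratios (and gives `0` for functions of no variables). -/
def lip {ι : Type} [Fintype ι] (F : (ι → ℝ) → ℝ) : ℝ :=
  ⨆ q : (ι → ℝ) × (ι → ℝ), |F q.1 - F q.2| / ∑ i, |q.1 i - q.2 i|

/-- `(BL, θ)`-dependence of a square-integrable random field. Only the values `θ r`, `r ≥ 1`,
matter, since disjoint finite sets are at distance at least `1`. -/
structure IsBLDependent {d : ℕ} {Ω : Type*} [MeasurableSpace Ω] (P : Measure Ω)
    (X : Lat d → Ω → ℝ) (θ : ℕ → ℝ) : Prop where
  memLp_two : ∀ j, MemLp (X j) 2 P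
  pos : ∀ r, 1 ≤ r → 0 < θ r
  tendsto_zero : Tendsto θ atTop (𝓝 0)
  cov_le : ∀ I J : Finset (Lat d), I.Nonempty → J.Nonempty → Disjoint I J →
    ∀ (f : (I → ℝ) → ℝ) (g : (J → ℝ) → ℝ), IsBdd f → IsLip f → IsBdd g → IsLip g →
      |covariance (fun ω => f fun i => X i ω) (fun ω => g fun j => X j ω) P| ≤
        lip f * lip g * ((min I.card J.card : ℕ) : ℝ) * θ (setDist I J)

/-- The lattice block `(a, b] = (a_1, b_1] × ⋯ × (a_d, b_d]`. -/
def block {d : ℕ} (a b : Lat d) : Finset (Lat d) :=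
  Fintype.piFinset fun i => Finset.Ioc (a i) (b i)

/-- `V` is a (nondegenerate) block. -/
def IsBlock {d : ℕ} (V : Finset (Lat d)) : Prop :=
  ∃ a b : Lat d, (∀ i, a i < b i) ∧ V = block a b

/-- The partial sum `S(V)`. -/
def S {d : ℕ} {Ω : Type*} (X : Lat d → Ω → ℝ) (V : Finset (Lat d)) (ω : Ω) : ℝ :=
  ∑ j ∈ V, X j ω

/-- `M(V)`, the maximum of `|S(W)|` over all blocks `W ⊆ V` (a finite family, nonempty when `V`
is a block). -/
def M {d : ℕ} {Ω : Type*} (X : Lat d → Ω → ℝ) (V : Finset (Lat d)) (ω : Ω) : ℝ :=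
  ⨆ W : {W : Finset (Lat d) // IsBlock W ∧ W ⊆ V}, |S X W.1 ω|

/-- The absolute moment `E|Y|^q`, as an extended nonnegative number. -/
def absMoment {Ω : Type*} [MeasurableSpace Ω] (P : Measure Ω) (Y : Ω → ℝ) (q : ℝ) : ℝ≥0∞ :=
  ∫⁻ ω, ENNReal.ofReal (|Y ω| ^ q) ∂P

/-- `D_p = sup_j E|X_j|^p`. -/
def momentSup {d : ℕ} {Ω : Type*} [MeasurableSpace Ω] (P : Measure Ω)
    (X : Lat d → Ω → ℝ) (p : ℝ) : ℝ≥0∞ :=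
  ⨆ j, absMoment P (X j) p

/-- The maximal real root of `t³ + 2t² - 7t - 4` (approximately `2.1413`). -/
def t0 : ℝ := sSup {t : ℝ | t ^ 3 + 2 * t ^ 2 - 7 * t - 4 = 0}

theorem isGreatest_t0 : IsGreatest {t : ℝ | t ^ 3 + 2 * t ^ 2 - 7 * t - 4 = 0} t0 := by
  have hb : BddAbove {t : ℝ | t ^ 3 + 2 * t ^ 2 - 7 * t - 4 = 0} := by
    refine ⟨3, fun t ht => ?_⟩
    simp only [Set.mem_ofPred_eq] at ht
    by_contra h
    push Not at h
    nlinarith [mul_pos (sub_pos.2 h) (sub_pos.2 h), mul_pos (mul_pos (sub_pos.2 h) (sub_pos.2 h)) (sub_pos.2 h)]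
  have hn : {t : ℝ | t ^ 3 + 2 * t ^ 2 - 7 * t - 4 = 0}.Nonempty := by
    have hc : ContinuousOn (fun t : ℝ => t ^ 3 + 2 * t ^ 2 - 7 * t - 4) (Set.Icc 2 3) := by
      fun_prop
    obtain ⟨t, -, ht⟩ := intermediate_value_Icc (by norm_num : (2 : ℝ) ≤ 3) hc
      (show (0 : ℝ) ∈ _ by constructor <;> norm_num)
    exact ⟨t, ht⟩
  exact ⟨(isClosed_eq (by fun_prop) (by fun_prop)).csSup_mem hn hb, fun _ ht => le_csSup hb ht⟩

/-- The function `ψ` on `(2, ∞)` governing the rate of decrease of `θ`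
(its values elsewhere are irrelevant). -/
def psi (x : ℝ) : ℝ :=
  if x ≤ 4 then (x - 1) / (x - 2)
  else if x ≤ t0 ^ 2 then (3 - √x) * (√x + 1) / 2
  else ((x - 1) * √((x - 2) ^ 2 - 3) - x ^ 2 + 6 * x - 11) / (3 * x - 12)

/-- The constant `A = 5^d (1 - 2^{-δ/(4+2δ)})^{-d(2+δ)}` of the maximal inequality. -/
def maxConst (d : ℕ) (δ : ℝ) : ℝ :=
  5 ^ d * (1 - (2 : ℝ) ^ (-(δ / (4 + 2 * δ)))) ^ (-((d : ℝ) * (2 + δ)))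

end BLField

end

namespace BLField

/-! Write q = 2 + δ. The exponent δ may be as small as desired, so polynomial decay of θ at any rate
λ > 0 suffices: the hypothesis on λ enters only through `psi_pos`.

Moment bound (`IsBLDependent.absMoment_S_block_le`), by induction on the cardinality n of a block:
cut the longest edge, of length l with l^d ≥ n, into two near-halves I, J and a gap G between them
of relative width at most ε. Since q/2 > 1, the sum E|S(I)|^q + E|S(J)|^q is a proper fraction of
the target. The mixed moments E|S(I)|^{1+δ}|S(J)| are O(n^{q/2}): truncating at T = n^β leaves a
covariance of order T^δ n l^{-λ}, a product of means controlled by E S² = O(n), and a tail T^{q-p}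
n^p. A large β kills the tail, and then a small δ makes T^δ ≤ l^λ. The gap is restored by Minkowski
at cost √ε, and a large constant absorbs the mixed moments.

Maximal bound (`lintegral_partialMax_le`): the moment bound grows like the volume to a power above
1, so bisection yields a one-dimensional maximal inequality with a fixed factor. It is applied one
coordinate direction after another. -/

theorem psi_pos {p : ℝ} (hp : 2 < p) : 0 < psi p := by
  have ht := isGreatest_t0
  have heq : t0 ^ 3 + 2 * t0 ^ 2 - 7 * t0 - 4 = 0 := ht.1
  have ht2 : 2 ≤ t0 := by
    have hc : ContinuousOn (fun t : ℝ => t ^ 3 + 2 * t ^ 2 - 7 * t - 4) (Set.Icc 2 3) := by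
      fun_prop
    obtain ⟨t, h, h'⟩ := intermediate_value_Icc (by norm_num : (2 : ℝ) ≤ 3) hc
      (show (0 : ℝ) ∈ _ by constructor <;> norm_num)
    exact h.1.trans (ht.2 h')
  have ht3 : t0 < 3 := by
    by_contra! h
    nlinarith [mul_nonneg (sub_nonneg.2 h) (sub_nonneg.2 h),
      mul_nonneg (mul_nonneg (sub_nonneg.2 h) (sub_nonneg.2 h)) (sub_nonneg.2 h)]
  unfold psi
  split_ifs with h1 h2
  · exact div_pos (by linarith) (by linarith)
  · have hs : √p ≤ t0 := (Real.sqrt_le_left (by linarith)).2 h2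
    have := Real.sqrt_nonneg p
    have : 0 < (3 - √p) * (√p + 1) := mul_pos (by linarith) (by linarith)
    linarith
  · push Not at h1
    refine div_pos ?_ (by linarith)
    have hpos : 0 < p ^ 2 - 6 * p + 11 := by nlinarith [sq_nonneg (p - 3)]
    have hr : (p ^ 2 - 6 * p + 11) / (p - 1) < √((p - 2) ^ 2 - 3) := by
      apply Real.lt_sqrt_of_sq_lt
      rw [div_pow, div_lt_iff₀ (by nlinarith)]
      -- (p - 1)²((p - 2)² - 3) - (p² - 6p + 11)² = 6(p - 4)(p² - 4p + 5).
      have : 0 < (p - 4) * (p ^ 2 - 4 * p + 5) :=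
        mul_pos (by linarith) (by nlinarith [sq_nonneg (p - 2)])
      nlinarith
    rw [div_lt_iff₀ (by linarith)] at hr
    linarith

/-! ### Elementary inequalities for real powers -/

/-- Splitting a total length into two parts, neither of which exceeds two thirds of it, gains a
factor for powers of exponent larger than one. -/
theorem rpow_add_rpow_le_two_thirds {x y l s : ℝ} (hx : 0 ≤ x) (hy : 0 ≤ y) (hxy : x + y ≤ l)
    (hx' : x ≤ 2 / 3 * l) (hy' : y ≤ 2 / 3 * l) (hs : 1 < s) :
    x ^ s + y ^ s ≤ (2 / 3 : ℝ) ^ (s - 1) * l ^ s := by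
  have hl : 0 ≤ l := by linarith
  have key : ∀ z : ℝ, 0 ≤ z → z ≤ 2 / 3 * l → z ^ s ≤ z * ((2 / 3 : ℝ) ^ (s - 1) * l ^ (s - 1)) := by
    intro z hz hz'
    rw [← Real.mul_rpow (by norm_num) hl]
    calc z ^ s = z * z ^ (s - 1) := by
          rw [← Real.rpow_one_add' hz (by linarith)]; ring_nf
      _ ≤ _ := by gcongr
  calc x ^ s + y ^ s ≤ (x + y) * ((2 / 3 : ℝ) ^ (s - 1) * l ^ (s - 1)) := by
        rw [add_mul]; exact add_le_add (key x hx hx') (key y hy hy')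
    _ ≤ l * ((2 / 3 : ℝ) ^ (s - 1) * l ^ (s - 1)) := by gcongr
    _ = (2 / 3 : ℝ) ^ (s - 1) * (l * l ^ (s - 1)) := by ring
    _ = _ := by
        rw [← Real.rpow_one_add' hl (by linarith)]; ring_nf

/-- Bernoulli's inequality at b/a - 1, rescaled by a^s. -/
theorem rpow_sub_rpow_le {a b s : ℝ} (hb : 0 ≤ b) (hab : b ≤ a) (hs : 1 ≤ s) :
    a ^ s - b ^ s ≤ s * a ^ (s - 1) * (a - b) := by
  rcases (hb.trans hab).eq_or_lt with rfl | ha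
  · obtain rfl : b = 0 := le_antisymm hab hb
    simp
  have h := one_add_mul_self_le_rpow_one_add (s := b / a - 1)
    (by linarith [div_nonneg hb ha.le]) hs
  rw [add_sub_cancel, Real.div_rpow hb ha.le, le_div_iff₀ (by positivity)] at h
  have h2 : a ^ s = a ^ (s - 1) * a := by
    rw [← Real.rpow_add_one ha.ne', sub_add_cancel]
  have h3 : (1 + s * (b / a - 1)) * a ^ s = a ^ s + s * a ^ (s - 1) * (b - a) := by
    rw [h2]; field_simp
  linarith

/-- Here 12 = 3 · 4, from 2 + δ ≤ 3 and (u + v)^{1+δ} ≤ (2u)^{1+δ} ≤ 4u^{1+δ}. -/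
theorem add_rpow_le {u v δ : ℝ} (hv : 0 ≤ v) (hvu : v ≤ u) (hδ : 0 < δ) (hδ1 : δ ≤ 1) :
    (u + v) ^ (2 + δ) ≤ u ^ (2 + δ) + 12 * (u ^ (1 + δ) * v) := by
  have hu := hv.trans hvu
  have h := rpow_sub_rpow_le (a := u + v) (b := u) (s := 2 + δ) hu (by linarith) (by linarith)
  have h2 : (u + v) ^ (2 + δ - 1) ≤ 4 * u ^ (1 + δ) := by
    calc (u + v) ^ (2 + δ - 1) ≤ (2 * u) ^ (1 + δ) := by
          rw [show 2 + δ - 1 = 1 + δ by ring]; gcongr; linarith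
      _ = 2 ^ (1 + δ) * u ^ (1 + δ) := Real.mul_rpow (by norm_num) hu
      _ ≤ 2 ^ (2 : ℝ) * u ^ (1 + δ) := by
          gcongr
          · norm_num
          · linarith
      _ = _ := by norm_num
  have h3 : (2 + δ) * (u + v) ^ (2 + δ - 1) * (u + v - u) ≤ 3 * (4 * u ^ (1 + δ)) * v := by
    rw [add_sub_cancel_left]; gcongr; linarith
  linarith

theorem abs_add_rpow_le (x y : ℝ) {δ : ℝ} (hδ : 0 < δ) (hδ1 : δ ≤ 1) :
    |x + y| ^ (2 + δ) ≤ |x| ^ (2 + δ) + |y| ^ (2 + δ)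
      + 12 * (|x| ^ (1 + δ) * |y| + |y| ^ (1 + δ) * |x|) := by
  have h0 : |x + y| ^ (2 + δ) ≤ (|x| + |y|) ^ (2 + δ) := by
    gcongr; exact abs_add_le x y
  refine h0.trans ?_
  have hx : 0 ≤ |x| ^ (2 + δ) + 12 * (|x| ^ (1 + δ) * |y|) := by positivity
  have hy : 0 ≤ |y| ^ (2 + δ) + 12 * (|y| ^ (1 + δ) * |x|) := by positivity
  rcases le_total |y| |x| with h | h
  · linarith [add_rpow_le (abs_nonneg y) h hδ hδ1, (by positivity : 0 ≤ |y| ^ (2 + δ)),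
      (by positivity : 0 ≤ |y| ^ (1 + δ) * |x|)]
  · rw [add_comm |x| |y|]
    linarith [add_rpow_le (abs_nonneg x) h hδ hδ1, (by positivity : 0 ≤ |x| ^ (2 + δ)),
      (by positivity : 0 ≤ |x| ^ (1 + δ) * |y|)]

/-- If u or v exceeds T, the product is at most max(u, v)^{2+δ}, and the negative power 2 + δ - p of
the maximum is at most that of T. -/
theorem rpow_mul_le_truncated {u v T δ p : ℝ} (hu : 0 ≤ u) (hv : 0 ≤ v) (hT : 0 < T) (hδ : 0 < δ)
    (hp : 2 + δ < p) :
    u ^ (1 + δ) * v ≤ min u T ^ (1 + δ) * min v T + T ^ (2 + δ - p) * (u ^ p + v ^ p) := by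
  by_cases h : u ≤ T ∧ v ≤ T
  · rw [min_eq_left h.1, min_eq_left h.2]
    have : 0 ≤ T ^ (2 + δ - p) * (u ^ p + v ^ p) := by positivity
    linarith
  · have hm : T < max u v := by
      rw [lt_max_iff]; by_contra hh; push Not at hh; exact h hh
    have hm0 := hT.trans hm
    have h1 : u ^ (1 + δ) * v ≤ max u v ^ (2 + δ) := by
      rw [show 2 + δ = 1 + δ + 1 by ring, Real.rpow_add_one hm0.ne']
      gcongr
      · exact le_max_left _ _
      · exact le_max_right _ _
    have h2 : max u v ^ (2 + δ) = max u v ^ (2 + δ - p) * max u v ^ p := by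
      rw [← Real.rpow_add hm0]; ring_nf
    have h3 : max u v ^ (2 + δ - p) ≤ T ^ (2 + δ - p) :=
      Real.rpow_le_rpow_of_nonpos hT hm.le (by linarith)
    have h4 : max u v ^ p ≤ u ^ p + v ^ p := by
      rcases max_cases u v with ⟨h, -⟩ | ⟨h, -⟩ <;> rw [h]
      · linarith [Real.rpow_nonneg hv p]
      · linarith [Real.rpow_nonneg hu p]
    have h5 : 0 ≤ min u T ^ (1 + δ) * min v T := by positivity
    calc _ ≤ max u v ^ (2 + δ - p) * max u v ^ p := h1.trans h2.le
      _ ≤ T ^ (2 + δ - p) * (u ^ p + v ^ p) := by gcongr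
      _ ≤ _ := by linarith

/-- A pointwise substitute for Lyapunov's inequality: after integration, a second moment at most v
bounds the s-th moment by 2v^{s/2}. The two cases compare u with √v. -/
theorem rpow_le_of_sq {u v s : ℝ} (hu : 0 ≤ u) (hv : 0 < v) (hs : 0 < s) (hs2 : s ≤ 2) :
    u ^ s ≤ v ^ (s / 2) * (1 + u ^ 2 / v) := by
  have hsq : v ^ (s / 2) = √v ^ s := by
    rw [Real.sqrt_eq_rpow, ← Real.rpow_mul hv.le]; ring_nf
  have hsv := Real.sqrt_pos.2 hv
  rcases le_total u √v with h | h
  · calc u ^ s ≤ √v ^ s := by gcongr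
      _ ≤ √v ^ s * (1 + u ^ 2 / v) :=
        le_mul_of_one_le_right (by positivity) (by linarith [(by positivity : 0 ≤ u ^ 2 / v)])
      _ = _ := by rw [hsq]
  · have hu0 := hsv.trans_le h
    have h1 : u ^ s = u ^ (s - 2) * u ^ 2 := by
      rw [← Real.rpow_natCast, ← Real.rpow_add hu0]; norm_num
    have h2 : √v ^ s = √v ^ (s - 2) * v := by
      conv_rhs => rw [← Real.sq_sqrt hv.le, Real.sqrt_sq hsv.le]
      rw [← Real.rpow_natCast, ← Real.rpow_add hsv]; norm_num
    have h3 : u ^ (s - 2) ≤ √v ^ (s - 2) := Real.rpow_le_rpow_of_nonpos hsv h (by linarith)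
    calc u ^ s ≤ √v ^ (s - 2) * u ^ 2 := by rw [h1]; gcongr
      _ = √v ^ s * (u ^ 2 / v) := by rw [h2]; field_simp
      _ ≤ √v ^ s * (1 + u ^ 2 / v) := by gcongr; linarith
      _ = _ := by rw [hsq]

/-! ### Moments of one and two random variables -/

section Moments

variable {Ω : Type*} [MeasurableSpace Ω] {P : Measure Ω}

theorem integral_le_of_sq [IsProbabilityMeasure P] {Y f : Ω → ℝ} (hY : MemLp Y 2 P) {v s : ℝ}
    (hv : 0 < v) (hYv : ∫ ω, Y ω ^ 2 ∂P ≤ v) (hs : 0 < s) (hs2 : s ≤ 2)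
    (hf : Integrable f P) (hfY : ∀ ω, f ω ≤ |Y ω| ^ s) : ∫ ω, f ω ∂P ≤ 2 * v ^ (s / 2) := by
  have hi : Integrable (fun ω => Y ω ^ 2) P := hY.integrable_sq
  calc ∫ ω, f ω ∂P ≤ ∫ ω, v ^ (s / 2) * (1 + Y ω ^ 2 / v) ∂P := by
        refine integral_mono hf (((integrable_const _).add (hi.div_const v)).const_mul _) ?_
        intro ω
        have := rpow_le_of_sq (abs_nonneg (Y ω)) hv hs hs2
        rw [sq_abs] at this
        exact (hfY ω).trans this
    _ = v ^ (s / 2) * (1 + (∫ ω, Y ω ^ 2 ∂P) / v) := by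
        rw [integral_const_mul, integral_add (integrable_const _) (hi.div_const v),
          integral_div]
        simp
    _ ≤ v ^ (s / 2) * (1 + 1) := by
        gcongr
        exact (div_le_one hv).2 hYv
    _ = _ := by ring

/-- The expected truncated product is a covariance plus a product of means, the latter at most
2v^{(1+δ)/2} · 2v^{1/2}; the last summand is the truncation error. -/
theorem lintegral_rpow_mul_le [IsProbabilityMeasure P] {Y Z : Ω → ℝ} (hYm : Measurable Y)
    (hZm : Measurable Z) (hY : MemLp Y 2 P) (hZ : MemLp Z 2 P) {δ p T v w κ : ℝ} (hδ : 0 < δ)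
    (hδ1 : δ ≤ 1) (hp : 2 + δ < p) (hT : 0 < T) (hv : 0 < v) (hw : 0 ≤ w)
    (hY2 : ∫ ω, Y ω ^ 2 ∂P ≤ v) (hZ2 : ∫ ω, Z ω ^ 2 ∂P ≤ v)
    (hYp : absMoment P Y p ≤ ENNReal.ofReal w) (hZp : absMoment P Z p ≤ ENNReal.ofReal w)
    (hκ0 : 0 ≤ κ)
    (hκ : |covariance (fun ω => min |Y ω| T ^ (1 + δ)) (fun ω => min |Z ω| T) P| ≤ κ) :
    ∫⁻ ω, ENNReal.ofReal (|Y ω| ^ (1 + δ) * |Z ω|) ∂P ≤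
      ENNReal.ofReal (κ + 4 * v ^ (1 + δ / 2) + 2 * T ^ (2 + δ - p) * w) := by
  set f : Ω → ℝ := fun ω => min |Y ω| T ^ (1 + δ) with hf
  set g : Ω → ℝ := fun ω => min |Z ω| T with hg
  have hf0 : ∀ ω, 0 ≤ f ω := fun ω => by positivity
  have hg0 : ∀ ω, 0 ≤ g ω := fun ω => by positivity
  have hfm : Measurable f := by fun_prop
  have hgm : Measurable g := by fun_prop
  have hfL : MemLp f 2 P := by
    refine MemLp.of_bound hfm.aestronglyMeasurable (T ^ (1 + δ)) (ae_of_all _ fun ω => ?_)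
    rw [Real.norm_of_nonneg (hf0 ω)]
    exact Real.rpow_le_rpow (by positivity) (min_le_right _ _) (by linarith)
  have hgL : MemLp g 2 P := by
    refine MemLp.of_bound hgm.aestronglyMeasurable T (ae_of_all _ fun ω => ?_)
    rw [Real.norm_of_nonneg (hg0 ω)]
    exact min_le_right _ _
  have hEf : ∫ ω, f ω ∂P ≤ 2 * v ^ ((1 + δ) / 2) :=
    integral_le_of_sq hY hv hY2 (by linarith) (by linarith) (hfL.integrable (by norm_num))
      fun ω => Real.rpow_le_rpow (by positivity) (min_le_left _ _) (by linarith)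
  have hEg : ∫ ω, g ω ∂P ≤ 2 * v ^ ((1 : ℝ) / 2) :=
    integral_le_of_sq hZ hv hZ2 (by norm_num) (by norm_num) (hgL.integrable (by norm_num))
      fun ω => by rw [Real.rpow_one]; exact min_le_left _ _
  have hprod : (∫ ω, f ω ∂P) * ∫ ω, g ω ∂P ≤ 4 * v ^ (1 + δ / 2) := by
    calc _ ≤ (2 * v ^ ((1 + δ) / 2)) * (2 * v ^ ((1 : ℝ) / 2)) :=
          mul_le_mul hEf hEg (integral_nonneg hg0) (by positivity)
      _ = 4 * (v ^ ((1 + δ) / 2) * v ^ ((1 : ℝ) / 2)) := by ring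
      _ = _ := by rw [← Real.rpow_add hv]; ring_nf
  have hfg : ∫ ω, f ω * g ω ∂P ≤ κ + 4 * v ^ (1 + δ / 2) := by
    have h := covariance_eq_sub hfL hgL
    have h2 := (le_abs_self _).trans hκ
    simp only [Pi.mul_apply] at h
    linarith
  have hfgi : Integrable (fun ω => f ω * g ω) P := hfL.integrable_mul hgL
  have hTp : 0 ≤ T ^ (2 + δ - p) := by positivity
  calc ∫⁻ ω, ENNReal.ofReal (|Y ω| ^ (1 + δ) * |Z ω|) ∂P
      ≤ ∫⁻ ω, (ENNReal.ofReal (f ω * g ω) + ENNReal.ofReal (T ^ (2 + δ - p)) *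
          (ENNReal.ofReal (|Y ω| ^ p) + ENNReal.ofReal (|Z ω| ^ p))) ∂P := by
        refine lintegral_mono fun ω => ?_
        rw [← ENNReal.ofReal_add (by positivity) (by positivity), ← ENNReal.ofReal_mul hTp,
          ← ENNReal.ofReal_add (mul_nonneg (hf0 ω) (hg0 ω)) (by positivity)]
        exact ENNReal.ofReal_le_ofReal
          (rpow_mul_le_truncated (abs_nonneg _) (abs_nonneg _) hT hδ hp)
    _ = ENNReal.ofReal (∫ ω, f ω * g ω ∂P) + ENNReal.ofReal (T ^ (2 + δ - p)) *
          (absMoment P Y p + absMoment P Z p) := by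
        rw [lintegral_add_left (by fun_prop), lintegral_const_mul _ (by fun_prop),
          lintegral_add_left (by fun_prop),
          ofReal_integral_eq_lintegral_ofReal hfgi
            (ae_of_all _ fun ω => mul_nonneg (hf0 ω) (hg0 ω))]
        rfl
    _ ≤ ENNReal.ofReal (κ + 4 * v ^ (1 + δ / 2)) + ENNReal.ofReal (T ^ (2 + δ - p)) *
          (ENNReal.ofReal w + ENNReal.ofReal w) := by gcongr
    _ = _ := by
        rw [← ENNReal.ofReal_add hw hw, ← ENNReal.ofReal_mul hTp,
          ← ENNReal.ofReal_add (by positivity) (by positivity)]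
        ring_nf

theorem absMoment_eq_lintegral_enorm (Y : Ω → ℝ) {q : ℝ} (hq : 0 ≤ q) :
    absMoment P Y q = ∫⁻ ω, ‖Y ω‖ₑ ^ q ∂P := by
  unfold absMoment
  refine lintegral_congr fun ω => ?_
  rw [← ENNReal.ofReal_rpow_of_nonneg (abs_nonneg _) hq, ← Real.enorm_abs,
    Real.enorm_eq_ofReal (abs_nonneg _)]

/-- Minkowski's inequality, for nonnegative functions with given bounds on their `q`-norms. -/
theorem lintegral_add_rpow_le {f g : Ω → ℝ≥0∞} (hf : Measurable f) (hg : Measurable g) {q : ℝ}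
    (hq : 1 ≤ q) {a b : ℝ} (ha : 0 ≤ a) (hb : 0 ≤ b)
    (hfa : ∫⁻ ω, f ω ^ q ∂P ≤ ENNReal.ofReal (a ^ q))
    (hgb : ∫⁻ ω, g ω ^ q ∂P ≤ ENNReal.ofReal (b ^ q)) :
    ∫⁻ ω, (f ω + g ω) ^ q ∂P ≤ ENNReal.ofReal ((a + b) ^ q) := by
  have hq0 : 0 < q := by linarith
  rw [← ENNReal.ofReal_rpow_of_nonneg (by assumption) hq0.le] at hfa hgb
  rw [← ENNReal.ofReal_rpow_of_nonneg (by positivity) hq0.le]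
  have h := ENNReal.lintegral_Lp_add_le (μ := P) hf.aemeasurable hg.aemeasurable hq
  calc ∫⁻ ω, (f ω + g ω) ^ q ∂P
      ≤ ((∫⁻ ω, f ω ^ q ∂P) ^ (1 / q) + (∫⁻ ω, g ω ^ q ∂P) ^ (1 / q)) ^ q := by
        rw [← ENNReal.rpow_inv_le_iff hq0, ← one_div]; exact h
    _ ≤ (ENNReal.ofReal a + ENNReal.ofReal b) ^ q := by
        gcongr <;> rw [one_div] <;> exact (ENNReal.rpow_inv_le_iff hq0).2 (by assumption)
    _ = _ := by rw [ENNReal.ofReal_add ha hb]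

/-- Minkowski's inequality for absolute moments. -/
theorem absMoment_add_le {Y Z : Ω → ℝ} (hY : Measurable Y) (hZ : Measurable Z) {q : ℝ}
    (hq : 1 ≤ q) {a b : ℝ} (ha : 0 ≤ a) (hb : 0 ≤ b)
    (hYa : absMoment P Y q ≤ ENNReal.ofReal (a ^ q))
    (hZb : absMoment P Z q ≤ ENNReal.ofReal (b ^ q)) :
    absMoment P (fun ω => Y ω + Z ω) q ≤ ENNReal.ofReal ((a + b) ^ q) := by
  rw [absMoment_eq_lintegral_enorm _ (by linarith)] at *
  refine (lintegral_mono fun ω => ?_).trans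
    (lintegral_add_rpow_le hY.enorm hZ.enorm hq ha hb hYa hZb)
  gcongr
  exact enorm_add_le _ _

end Moments

/-! ### Distances in the lattice -/

section Lattice

variable {d : ℕ}

theorem supNorm_sub_comm (i j : Lat d) : supNorm (i - j) = supNorm (j - i) := by
  unfold supNorm
  congr 1
  ext k
  simp only [Pi.sub_apply]
  omega

theorem supNorm_pos {z : Lat d} (hz : z ≠ 0) : 1 ≤ supNorm z := by
  obtain ⟨i, hi⟩ := Function.ne_iff.1 hz
  have h : (z i).natAbs ≤ supNorm z := Finset.le_sup (f := fun i => (z i).natAbs) (Finset.mem_univ i)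
  have : (z i).natAbs ≠ 0 := by simpa using hi
  omega

theorem le_setDist {I J : Finset (Lat d)} (hI : I.Nonempty) (hJ : J.Nonempty) {r : ℕ}
    (h : ∀ i ∈ I, ∀ j ∈ J, r ≤ supNorm (i - j)) : r ≤ setDist I J := by
  obtain ⟨i, hi⟩ := hI
  obtain ⟨j, hj⟩ := hJ
  refine le_csInf ⟨_, i, hi, j, hj, rfl⟩ ?_
  rintro _ ⟨i, hi, j, hj, rfl⟩
  exact h i hi j hj

end Lattice

/-! ### Consequences of BL-dependence for partial sums -/

section Dependence

variable {d : ℕ} {Ω : Type*} [MeasurableSpace Ω] {P : Measure Ω} {X : Lat d → Ω → ℝ} {θ : ℕ → ℝ}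

theorem measurable_S (hX : ∀ j, Measurable (X j)) (V : Finset (Lat d)) : Measurable (S X V) :=
  Finset.measurable_sum _ fun j _ => hX j

theorem lip_nonneg {ι : Type} [Fintype ι] (F : (ι → ℝ) → ℝ) : 0 ≤ lip F :=
  Real.iSup_nonneg fun _ => by positivity

theorem lip_comp_sum_le {ι : Type} [Fintype ι] {φ : ℝ → ℝ} {K : ℝ} (hK : 0 ≤ K)
    (hφ : ∀ x y, |φ x - φ y| ≤ K * |x - y|) :
    IsLip (fun x : ι → ℝ => φ (∑ i, x i)) ∧ lip (fun x : ι → ℝ => φ (∑ i, x i)) ≤ K := by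
  have h : ∀ x y : ι → ℝ, |φ (∑ i, x i) - φ (∑ i, y i)| ≤ K * ∑ i, |x i - y i| := by
    intro x y
    refine (hφ _ _).trans ?_
    rw [← Finset.sum_sub_distrib]
    gcongr
    exact Finset.abs_sum_le_sum_abs _ _
  refine ⟨⟨K, h⟩, ciSup_le fun q => ?_⟩
  exact div_le_of_le_mul₀ (by positivity) hK (h q.1 q.2)

/-- The covariance inequality for bounded Lipschitz functions of two partial sums. -/
theorem IsBLDependent.abs_cov_comp_S_le (hX : IsBLDependent P X θ) {I J : Finset (Lat d)}
    (hI : I.Nonempty) (hJ : J.Nonempty) {R : ℕ} (hR : 1 ≤ R)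
    (hIJ : ∀ i ∈ I, ∀ j ∈ J, R ≤ supNorm (i - j)) {c₀ lam : ℝ} (hc₀ : 0 ≤ c₀) (hlam : 0 ≤ lam)
    (hθ : ∀ r : ℕ, 1 ≤ r → θ r ≤ c₀ * (r : ℝ) ^ (-lam))
    {φ ψ : ℝ → ℝ} {K L A B : ℝ} (hK : 0 ≤ K) (hL : 0 ≤ L)
    (hφ : ∀ x y, |φ x - φ y| ≤ K * |x - y|) (hψ : ∀ x y, |ψ x - ψ y| ≤ L * |x - y|)
    (hA : ∀ x, |φ x| ≤ A) (hB : ∀ x, |ψ x| ≤ B) :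
    |covariance (fun ω => φ (S X I ω)) (fun ω => ψ (S X J ω)) P| ≤
      K * L * (min I.card J.card : ℕ) * (c₀ * (R : ℝ) ^ (-lam)) := by
  have hdisj : Disjoint I J := by
    rw [Finset.disjoint_left]
    intro i hi hj
    have := hIJ i hi i hj
    have h0 : supNorm (i - i) = 0 := by simp [supNorm]
    omega
  have hr := le_setDist hI hJ hIJ
  have h := hX.cov_le I J hI hJ hdisj (fun x => φ (∑ i, x i)) (fun x => ψ (∑ j, x j))
    ⟨A, fun x => hA _⟩ (lip_comp_sum_le hK hφ).1 ⟨B, fun x => hB _⟩ (lip_comp_sum_le hL hψ).1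
  have e : ∀ V : Finset (Lat d), ∀ ω, ∑ i : V, X i ω = S X V ω := fun V ω =>
    Finset.sum_coe_sort V (fun j => X j ω)
  simp only [e] at h
  refine h.trans ?_
  have hr0 : (0 : ℝ) < R := by exact_mod_cast hR
  have hθR : θ (setDist I J) ≤ c₀ * (R : ℝ) ^ (-lam) := by
    refine (hθ _ (hR.trans hr)).trans ?_
    gcongr c₀ * ?_
    exact Real.rpow_le_rpow_of_nonpos hr0 (by exact_mod_cast hr) (by linarith)
  have hθ0 := hX.pos _ (hR.trans hr)
  gcongr
  · exact lip_nonneg _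
  · exact (lip_comp_sum_le hK hφ).2
  · exact (lip_comp_sum_le hL hψ).2

theorem abs_clip_sub_le (T x y : ℝ) :
    |max (-T) (min T x) - max (-T) (min T y)| ≤ 1 * |x - y| := by
  rw [one_mul, max_comm, max_comm (-T)]
  refine (abs_max_sub_max_le_abs _ _ _).trans ?_
  rw [min_comm, min_comm T]
  refine (abs_min_sub_min_le_max _ _ _ _).trans ?_
  simp

theorem abs_clip_le {T : ℝ} (hT : 0 ≤ T) (x : ℝ) : |max (-T) (min T x)| ≤ T :=
  abs_le.2 ⟨le_max_left _ _, max_le (by linarith) (min_le_left _ _)⟩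

theorem abs_clip_le_abs {T : ℝ} (hT : 0 ≤ T) (x : ℝ) : |max (-T) (min T x)| ≤ |x| := by
  simpa [hT] using abs_clip_sub_le T x 0

theorem tendsto_clip (x : ℝ) :
    Tendsto (fun n : ℕ => max (-(n : ℝ)) (min (n : ℝ) x)) atTop (𝓝 x) := by
  refine tendsto_const_nhds.congr' ?_
  filter_upwards [eventually_ge_atTop ⌈|x|⌉₊] with n hn
  have h : |x| ≤ n := (Nat.le_ceil _).trans (by exact_mod_cast hn)
  rw [min_eq_right (abs_le.1 h).2, max_eq_right (abs_le.1 h).1]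

/-- BL-dependence only sees bounded functions. The identity is a limit of clips, all 1-Lipschitz,
and dominated convergence carries a uniform covariance bound to the limit. -/
theorem abs_cov_le_of_clip [IsProbabilityMeasure P] {Y Z : Ω → ℝ} (hYm : Measurable Y)
    (hZm : Measurable Z) (hY : MemLp Y 2 P) (hZ : MemLp Z 2 P) {κ : ℝ}
    (h : ∀ n : ℕ, |covariance (fun ω => max (-(n : ℝ)) (min (n : ℝ) (Y ω)))
      (fun ω => max (-(n : ℝ)) (min (n : ℝ) (Z ω))) P| ≤ κ) :
    |covariance Y Z P| ≤ κ := by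
  have hlim : ∀ {W : Ω → ℝ}, Measurable W → MemLp W 2 P →
      (∀ n : ℕ, MemLp (fun ω => max (-(n : ℝ)) (min (n : ℝ) (W ω))) 2 P) ∧
      Tendsto (fun n : ℕ => ∫ ω, max (-(n : ℝ)) (min (n : ℝ) (W ω)) ∂P) atTop
        (𝓝 (∫ ω, W ω ∂P)) := by
    intro W hWm hW
    refine ⟨fun n => hW.mono (by fun_prop) (ae_of_all _ fun ω => ?_), ?_⟩
    · exact abs_clip_le_abs n.cast_nonneg _
    · refine tendsto_integral_of_dominated_convergence (fun ω => |W ω|) (fun n => by fun_prop)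
        (hW.integrable (by norm_num)).abs (fun n => ae_of_all _ fun ω => ?_)
        (ae_of_all _ fun ω => tendsto_clip _)
      exact abs_clip_le_abs n.cast_nonneg _
  have hprod : Tendsto (fun n : ℕ => ∫ ω, max (-(n : ℝ)) (min (n : ℝ) (Y ω)) *
      max (-(n : ℝ)) (min (n : ℝ) (Z ω)) ∂P) atTop (𝓝 (∫ ω, Y ω * Z ω ∂P)) := by
    refine tendsto_integral_of_dominated_convergence (fun ω => |Y ω * Z ω|) (fun n => by fun_prop)
      (hY.integrable_mul hZ).abs (fun n => ae_of_all _ fun ω => ?_)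
      (ae_of_all _ fun ω => (tendsto_clip _).mul (tendsto_clip _))
    rw [Real.norm_eq_abs, abs_mul, abs_mul]
    exact mul_le_mul (abs_clip_le_abs n.cast_nonneg _) (abs_clip_le_abs n.cast_nonneg _)
      (abs_nonneg _) (abs_nonneg _)
  refine le_of_tendsto' (x := atTop) (f := fun n : ℕ =>
    |covariance (fun ω => max (-(n : ℝ)) (min (n : ℝ) (Y ω)))
      (fun ω => max (-(n : ℝ)) (min (n : ℝ) (Z ω))) P|) ?_ h
  refine Tendsto.abs ?_
  rw [covariance_eq_sub hY hZ]
  simp_rw [fun n => covariance_eq_sub ((hlim hYm hY).1 n) ((hlim hZm hZ).1 n)]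
  exact hprod.sub ((hlim hYm hY).2.mul (hlim hZm hZ).2)

theorem IsBLDependent.memLp_S (hX : IsBLDependent P X θ) (V : Finset (Lat d)) :
    MemLp (S X V) 2 P :=
  memLp_finsetSum (f := X) V fun j _ => hX.memLp_two j

theorem integral_sq_le_of_absMoment_le [IsProbabilityMeasure P] {Y : Ω → ℝ} (hY : Measurable Y)
    {p : ℝ} (hp : 2 < p) {D : ℝ≥0} (h : absMoment P Y p ≤ D) : ∫ ω, Y ω ^ 2 ∂P ≤ 1 + D := by
  rw [integral_eq_lintegral_of_nonneg_ae (ae_of_all _ fun ω => sq_nonneg _) (by fun_prop)]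
  refine ENNReal.toReal_le_of_le_ofReal (by positivity) ?_
  calc ∫⁻ ω, ENNReal.ofReal (Y ω ^ 2) ∂P
      ≤ ∫⁻ ω, (1 + ENNReal.ofReal (|Y ω| ^ p)) ∂P := by
        refine lintegral_mono fun ω => ?_
        rw [← ENNReal.ofReal_one, ← ENNReal.ofReal_add zero_le_one (by positivity)]
        refine ENNReal.ofReal_le_ofReal ?_
        rw [← sq_abs]
        rcases le_total |Y ω| 1 with h | h
        · have := pow_le_one₀ (abs_nonneg (Y ω)) h (n := 2)
          linarith [(by positivity : 0 ≤ |Y ω| ^ p)]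
        · have := Real.rpow_le_rpow_of_exponent_le h hp.le
          rw [Real.rpow_two] at this
          linarith
    _ = 1 + absMoment P Y p := by
        rw [lintegral_add_left (by fun_prop)]; simp [absMoment]
    _ ≤ 1 + D := by gcongr
    _ = ENNReal.ofReal (1 + (D : ℝ)) := by
        rw [ENNReal.ofReal_add zero_le_one D.coe_nonneg]; simp

/-- Expand E S² as Σ E[X_i S(V)] and compare each X_i with all the remaining variables at once. The
factor min(|I|, |J|) is then 1, so linear growth needs no summability of θ. -/
theorem IsBLDependent.integral_sq_S_le [IsProbabilityMeasure P] (hX : IsBLDependent P X θ)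
    (hXm : ∀ j, Measurable (X j)) (hX0 : ∀ j, ∫ ω, X j ω ∂P = 0) {v c₀ lam : ℝ} (hc₀ : 0 ≤ c₀)
    (hlam : 0 ≤ lam) (hθ : ∀ r : ℕ, 1 ≤ r → θ r ≤ c₀ * (r : ℝ) ^ (-lam))
    (hv : ∀ j, ∫ ω, X j ω ^ 2 ∂P ≤ v) (V : Finset (Lat d)) :
    ∫ ω, S X V ω ^ 2 ∂P ≤ (v + c₀) * V.card := by
  classical
  have hint : ∀ W i, Integrable (fun ω => X i ω * S X W ω) P := fun W i =>
    (hX.memLp_two i).integrable_mul (hX.memLp_S W)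
  have hterm : ∀ i ∈ V, ∫ ω, X i ω * S X V ω ∂P ≤ v + c₀ := by
    intro i hi
    have hsplit : ∀ ω, X i ω * S X V ω = X i ω ^ 2 + X i ω * S X (V.erase i) ω := by
      intro ω
      rw [S, ← Finset.add_sum_erase V _ hi, S]; ring
    simp_rw [hsplit]
    rw [integral_add (hX.memLp_two i).integrable_sq (hint _ i)]
    refine add_le_add (hv i) ?_
    rcases (V.erase i).eq_empty_or_nonempty with he | hne
    · simpa [he, S] using hc₀
    · have hcov : ∫ ω, X i ω * S X (V.erase i) ω ∂P = covariance (X i) (S X (V.erase i)) P := by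
        rw [covariance_eq_sub (hX.memLp_two i) (hX.memLp_S _), hX0 i]
        simp
      rw [hcov]
      refine (le_abs_self _).trans (abs_cov_le_of_clip (hXm i) (measurable_S hXm _)
        (hX.memLp_two i) (hX.memLp_S _) fun n => ?_)
      -- Distinct lattice points are at distance at least 1, so R = 1 and the bound is c₀ itself.
      have h := hX.abs_cov_comp_S_le (I := {i}) (Finset.singleton_nonempty i) hne le_rfl
        (fun k hk j hj => supNorm_pos (sub_ne_zero.2 ?_)) hc₀ hlam hθ zero_le_one zero_le_one
        (abs_clip_sub_le n) (abs_clip_sub_le n) (abs_clip_le n.cast_nonneg)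
        (abs_clip_le n.cast_nonneg)
      · have hS : ∀ ω, S X {i} ω = X i ω := fun ω => by simp [S]
        simp only [hS] at h
        rw [min_eq_left (by simpa using Finset.card_pos.2 hne)] at h
        simpa using h
      · rw [Finset.mem_singleton.1 hk]
        exact (Finset.ne_of_mem_erase hj).symm
  have hsum : ∀ ω, S X V ω ^ 2 = ∑ i ∈ V, X i ω * S X V ω := fun ω => by
    rw [← Finset.sum_mul, sq]; rfl
  simp_rw [hsum]
  rw [integral_finsetSum _ fun i _ => hint V i]
  calc _ ≤ ∑ i ∈ V, (v + c₀) := Finset.sum_le_sum hterm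
    _ = _ := by rw [Finset.sum_const, nsmul_eq_mul, mul_comm]

/-- Minkowski, one summand at a time. The crude power |V|^p is harmless, because the truncation
level may be any power of the volume. -/
theorem absMoment_S_le (hXm : ∀ j, Measurable (X j)) {p : ℝ} (hp : 1 ≤ p) {D : ℝ≥0}
    (hD : ∀ j, absMoment P (X j) p ≤ D) (V : Finset (Lat d)) :
    absMoment P (S X V) p ≤ ENNReal.ofReal ((V.card : ℝ) ^ p * D) := by
  classical
  have hp0 : 0 < p := by linarith
  have hD' : ((D : ℝ) ^ p⁻¹) ^ p = D := Real.rpow_inv_rpow D.2 hp0.ne'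
  have key : absMoment P (S X V) p ≤ ENNReal.ofReal (((V.card : ℝ) * (D : ℝ) ^ p⁻¹) ^ p) := by
    induction V using Finset.induction_on with
    | empty => simp [absMoment, S, Real.zero_rpow hp0.ne']
    | insert i V hi ih =>
      have h := absMoment_add_le (hXm i) (measurable_S hXm V) hp (a := (D : ℝ) ^ p⁻¹)
        (b := (V.card : ℝ) * (D : ℝ) ^ p⁻¹) (by positivity) (by positivity)
        (by rw [hD']; simpa using hD i) ih
      have e : S X (insert i V) = fun ω => X i ω + S X V ω := by
        ext ω; rw [S, Finset.sum_insert hi, S]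
      rw [e, Finset.card_insert_of_notMem hi]
      push_cast
      rwa [add_mul, one_mul, add_comm (_ * _)]
  rwa [Real.mul_rpow (by positivity) (by positivity), hD'] at key

end Dependence

/-! ### Maximal inequalities over integer intervals -/

section OneDimensional

variable {Ω : Type*} [MeasurableSpace Ω] {P : Measure Ω}

/-- ρ is the factor gained in q-norm when a length is split in two. The fraction 2/3 instead of 1/2
leaves room for odd lengths. -/
theorem exists_contraction {q : ℝ} (hq : 2 < q) :
    ∃ ρ : ℝ, 0 < ρ ∧ ρ < 1 ∧ ρ ^ q = (2 / 3 : ℝ) ^ (q / 2 - 1) := by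
  refine ⟨(2 / 3 : ℝ) ^ ((q / 2 - 1) / q), by positivity, ?_, ?_⟩
  · exact Real.rpow_lt_one (by norm_num) (by norm_num) (div_pos (by linarith) (by linarith))
  · rw [← Real.rpow_mul (by norm_num), div_mul_cancel₀ _ (by linarith)]

theorem add_rpow_halves_le {κ x y l q ρ : ℝ} (hκ : 0 ≤ κ) (hx : 0 ≤ x) (hy : 0 ≤ y)
    (hxy : x + y ≤ l) (hx' : x ≤ 2 / 3 * l) (hy' : y ≤ 2 / 3 * l) (hq : 2 < q) (hρ0 : 0 < ρ)
    (hρ : ρ ^ q = (2 / 3 : ℝ) ^ (q / 2 - 1)) :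
    (κ * √x) ^ q + (κ * √y) ^ q ≤ (κ * ρ * √l) ^ q := by
  have hl : 0 ≤ l := by linarith
  have e : ∀ z : ℝ, 0 ≤ z → √z ^ q = z ^ (q / 2) := fun z hz => by
    rw [Real.sqrt_eq_rpow, ← Real.rpow_mul hz]; ring_nf
  rw [Real.mul_rpow hκ (by positivity), Real.mul_rpow hκ (by positivity),
    Real.mul_rpow (by positivity) (by positivity), Real.mul_rpow hκ hρ0.le, e x hx, e y hy, e l hl,
    hρ, mul_assoc, ← mul_add]
  gcongr
  exact rpow_add_rpow_le_two_thirds hx hy hxy hx' hy' (by linarith)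

/-- The maximum over initial segments of a subadditive function of integer intervals. -/
theorem lintegral_iSup_prefix_le {q κ ρ : ℝ} (hq : 2 < q) (hκ : 0 ≤ κ) (hρ0 : 0 < ρ) (hρ1 : ρ < 1)
    (hρ : ρ ^ q = (2 / 3 : ℝ) ^ (q / 2 - 1)) {F : ℤ → ℤ → Ω → ℝ≥0∞}
    (hF : ∀ a b, Measurable (F a b))
    (hadd : ∀ a b c, a ≤ b → b ≤ c → ∀ ω, F a c ω ≤ F a b ω + F b c ω)
    (hK : ∀ a b, a ≤ b → ∫⁻ ω, F a b ω ^ q ∂P ≤ ENNReal.ofReal ((κ * √((b - a : ℤ) : ℝ)) ^ q))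
    (n : ℕ) (a : ℤ) :
    ∫⁻ ω, (⨆ v ∈ Set.Icc a (a + n), F a v ω) ^ q ∂P ≤
      ENNReal.ofReal ((κ * (1 - ρ)⁻¹ * √n) ^ q) := by
  have hB : 1 ≤ (1 - ρ)⁻¹ := (one_le_inv₀ (by linarith)).2 (by linarith)
  -- The bisection turns a constant B for the halves into 1 + Bρ for the whole; B = (1 - ρ)⁻¹ is the
  -- fixed point.
  have hBρ : 1 + (1 - ρ)⁻¹ * ρ = (1 - ρ)⁻¹ := by
    have : 1 - ρ ≠ 0 := by linarith
    field_simp; ring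
  have hHm : ∀ a b : ℤ, Measurable fun ω => ⨆ v ∈ Set.Icc a b, F a v ω := fun a b =>
    Measurable.biSup _ (Set.to_countable _) fun v _ => hF a v
  induction n using Nat.strong_induction_on generalizing a with
  | _ n ih =>
  rcases Nat.lt_or_ge n 2 with hn | hn
  · have hb := hK a (a + n) (by omega)
    have ha := hK a a le_rfl
    have h := lintegral_add_rpow_le (hF a a) (hF a (a + n)) (by linarith) (by positivity)
      (by positivity) ha hb
    refine le_trans (lintegral_mono fun ω => ?_) (h.trans (ENNReal.ofReal_le_ofReal ?_))
    · refine ENNReal.rpow_le_rpow (iSup₂_le fun v hv => ?_) (by linarith)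
      rcases (show v = a ∨ v = a + n by have := hv.1; have := hv.2; omega) with rfl | rfl
      · exact le_self_add
      · exact le_add_self
    · simp only [sub_self, Int.cast_zero, Real.sqrt_zero, mul_zero, zero_add, add_sub_cancel_left,
        Int.cast_natCast]
      gcongr
      exact le_mul_of_one_le_right hκ hB
  · set l₁ := n / 2 with hl₁
    set l₂ := n - n / 2 with hl₂
    have h1 := ih l₁ (by omega) a
    have h2 := ih l₂ (by omega) (a + l₁)
    have hend : a + l₁ + l₂ = a + n := by omega
    rw [hend] at h2
    set H₁ : Ω → ℝ≥0∞ := fun ω => ⨆ v ∈ Set.Icc a (a + l₁), F a v ω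
    set H₂ : Ω → ℝ≥0∞ := fun ω => ⨆ v ∈ Set.Icc (a + l₁) (a + n), F (a + l₁) v ω
    -- The q-th power of a maximum is at most the sum of the q-th powers, so here the splitting gain
    -- ρ applies. A prefix ending in the right half is the whole left half plus a prefix of the
    -- right one.
    have hmax : ∫⁻ ω, (max (H₁ ω) (H₂ ω)) ^ q ∂P ≤
        ENNReal.ofReal ((κ * (1 - ρ)⁻¹ * ρ * √n) ^ q) := by
      calc ∫⁻ ω, (max (H₁ ω) (H₂ ω)) ^ q ∂P ≤ ∫⁻ ω, (H₁ ω ^ q + H₂ ω ^ q) ∂P := by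
            refine lintegral_mono fun ω => ?_
            rcases max_cases (H₁ ω) (H₂ ω) with ⟨h, -⟩ | ⟨h, -⟩ <;> rw [h]
            · exact le_self_add
            · exact le_add_self
        _ = ∫⁻ ω, H₁ ω ^ q ∂P + ∫⁻ ω, H₂ ω ^ q ∂P :=
            lintegral_add_left ((hHm _ _).pow_const _) _
        _ ≤ ENNReal.ofReal ((κ * (1 - ρ)⁻¹ * √l₁) ^ q) +
            ENNReal.ofReal ((κ * (1 - ρ)⁻¹ * √l₂) ^ q) := add_le_add h1 h2
        _ ≤ _ := by
            rw [← ENNReal.ofReal_add (by positivity) (by positivity)]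
            have c1 : (l₁ : ℝ) + l₂ = n := by exact_mod_cast (by omega : l₁ + l₂ = n)
            have c2 : (3 : ℝ) * l₁ ≤ 2 * n := by exact_mod_cast (by omega : 3 * l₁ ≤ 2 * n)
            have c3 : (3 : ℝ) * l₂ ≤ 2 * n := by exact_mod_cast (by omega : 3 * l₂ ≤ 2 * n)
            exact ENNReal.ofReal_le_ofReal (add_rpow_halves_le (by positivity) (by positivity)
              (by positivity) c1.le (by linarith) (by linarith) hq hρ0 hρ)
    have h := lintegral_add_rpow_le (hF a (a + l₁)) ((hHm _ _).max (hHm _ _)) (by linarith)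
      (by positivity) (by positivity) (hK a (a + l₁) (by omega)) hmax
    refine le_trans (lintegral_mono fun ω => ?_) (h.trans (ENNReal.ofReal_le_ofReal ?_))
    · refine ENNReal.rpow_le_rpow (iSup₂_le fun v hv => ?_) (by linarith)
      rcases le_total v (a + l₁) with hv' | hv'
      · refine le_add_left (le_max_of_le_left ?_)
        exact le_iSup₂ (f := fun v (_ : v ∈ Set.Icc a (a + l₁)) => F a v ω) v ⟨hv.1, hv'⟩
      · refine (hadd a (a + l₁) v (by omega) hv' ω).trans ?_
        gcongr
        refine le_max_of_le_right ?_
        exact le_iSup₂ (f := fun v (_ : v ∈ Set.Icc (a + l₁) (a + n)) => F (a + l₁) v ω) v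
          ⟨hv', hv.2⟩
    · rw [add_sub_cancel_left, Int.cast_natCast]
      gcongr
      have c1 : √(l₁ : ℝ) ≤ √n := Real.sqrt_le_sqrt (by exact_mod_cast (by omega : l₁ ≤ n))
      calc κ * √l₁ + κ * (1 - ρ)⁻¹ * ρ * √n ≤ κ * √n + κ * (1 - ρ)⁻¹ * ρ * √n := by gcongr
        _ = κ * (1 + (1 - ρ)⁻¹ * ρ) * √n := by ring
        _ = _ := by rw [hBρ]

/-- The maximum over all subintervals of a function of integer intervals. -/
theorem lintegral_iSup_subinterval_le {q κ ρ : ℝ} (hq : 2 < q) (hκ : 0 ≤ κ) (hρ0 : 0 < ρ)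
    (hρ1 : ρ < 1) (hρ : ρ ^ q = (2 / 3 : ℝ) ^ (q / 2 - 1)) {F : ℤ → ℤ → Ω → ℝ≥0∞}
    (hF : ∀ a b, Measurable (F a b))
    (hadd : ∀ a b c, a ≤ b → b ≤ c → ∀ ω, F a c ω ≤ F a b ω + F b c ω)
    (hsub : ∀ a b c, a ≤ b → b ≤ c → ∀ ω, F b c ω ≤ F a b ω + F a c ω)
    (hK : ∀ a b, a ≤ b → ∫⁻ ω, F a b ω ^ q ∂P ≤ ENNReal.ofReal ((κ * √((b - a : ℤ) : ℝ)) ^ q))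
    {a b : ℤ} (hab : a ≤ b) :
    ∫⁻ ω, (⨆ u ∈ Set.Icc a b, ⨆ v ∈ Set.Icc u b, F u v ω) ^ q ∂P ≤
      ENNReal.ofReal ((κ * (2 * (1 - ρ)⁻¹) * √((b - a : ℤ) : ℝ)) ^ q) := by
  obtain ⟨n, rfl⟩ : ∃ n : ℕ, b = a + n := ⟨(b - a).toNat, by omega⟩
  have h := lintegral_iSup_prefix_le hq hκ hρ0 hρ1 hρ hF hadd hK n a
  have hm : Measurable fun ω => ⨆ v ∈ Set.Icc a (a + n), F a v ω :=
    Measurable.biSup _ (Set.to_countable _) fun v _ => hF a v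
  have hB : 0 ≤ (1 - ρ)⁻¹ := inv_nonneg.2 (by linarith)
  have h2 := lintegral_add_rpow_le hm hm (by linarith) (by positivity) (by positivity) h h
  refine le_trans (lintegral_mono fun ω => ?_) (h2.trans_eq ?_)
  · refine ENNReal.rpow_le_rpow (iSup₂_le fun u hu => iSup₂_le fun v hv => ?_) (by linarith)
    -- A subinterval is a difference of two prefixes, whence the factor 2.
    refine (hsub a u v hu.1 hv.1 ω).trans ?_
    gcongr
    · exact le_iSup₂ (f := fun v (_ : v ∈ Set.Icc a (a + n)) => F a v ω) u hu
    · exact le_iSup₂ (f := fun v (_ : v ∈ Set.Icc a (a + n)) => F a v ω) v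
        ⟨hu.1.trans hv.1, hv.2⟩
  · rw [add_sub_cancel_left, Int.cast_natCast]
    ring_nf

end OneDimensional

/-! ### Blocks and the multidimensional maximal inequality -/

section Blocks

variable {d : ℕ}

theorem mem_block {a b z : Lat d} : z ∈ block a b ↔ ∀ i, a i < z i ∧ z i ≤ b i := by
  simp [block]

theorem mem_block_update_right {a b z : Lat d} {i : Fin d} {m : ℤ} (hm : m ≤ b i) :
    z ∈ block a (Function.update b i m) ↔ z ∈ block a b ∧ z i ≤ m := by
  simp only [mem_block]
  constructor
  · intro h
    have hi := (h i).2
    rw [Function.update_self] at hi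
    refine ⟨fun j => ⟨(h j).1, ?_⟩, hi⟩
    rcases eq_or_ne j i with rfl | hj
    · exact hi.trans hm
    · simpa [hj] using (h j).2
  · rintro ⟨h, hi⟩ j
    refine ⟨(h j).1, ?_⟩
    rcases eq_or_ne j i with rfl | hj
    · simpa using hi
    · simpa [hj] using (h j).2

theorem mem_block_update_left {a b z : Lat d} {i : Fin d} {m : ℤ} (hm : a i ≤ m) :
    z ∈ block (Function.update a i m) b ↔ z ∈ block a b ∧ m < z i := by
  simp only [mem_block]
  constructor
  · intro h
    have hi := (h i).1
    rw [Function.update_self] at hi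
    refine ⟨fun j => ⟨?_, (h j).2⟩, hi⟩
    rcases eq_or_ne j i with rfl | hj
    · exact hm.trans_lt hi
    · simpa [hj] using (h j).1
  · rintro ⟨h, hi⟩ j
    refine ⟨?_, (h j).2⟩
    rcases eq_or_ne j i with rfl | hj
    · simpa using hi
    · simpa [hj] using (h j).1

theorem S_block_split {Ω : Type*} (X : Lat d → Ω → ℝ) {a b : Lat d} {i : Fin d} {m : ℤ}
    (ha : a i ≤ m) (hb : m ≤ b i) (ω : Ω) :
    S X (block a b) ω =
      S X (block a (Function.update b i m)) ω + S X (block (Function.update a i m) b) ω := by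
  have h1 : block a (Function.update b i m) = (block a b).filter fun z => z i ≤ m := by
    ext z; rw [mem_block_update_right hb, Finset.mem_filter]
  have h2 : block (Function.update a i m) b = (block a b).filter fun z => ¬ z i ≤ m := by
    ext z; rw [mem_block_update_left ha, Finset.mem_filter, not_le]
  rw [h1, h2]
  exact (Finset.sum_filter_add_sum_filter_not _ _ _).symm

theorem card_block (a b : Lat d) : (block a b).card = ∏ i, (b i - a i).toNat := by
  simp [block]

theorem card_block_update (a b : Lat d) (i : Fin d) (u v : ℤ) :
    (block (Function.update a i u) (Function.update b i v)).card =
      (v - u).toNat * ∏ j ∈ Finset.univ.erase i, (b j - a j).toNat := by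
  rw [card_block, ← Finset.mul_prod_erase _ _ (Finset.mem_univ i)]
  simp only [Function.update_self]
  congr 1
  refine Finset.prod_congr rfl fun j hj => ?_
  simp [Finset.ne_of_mem_erase hj]

/-- The blocks contained in `(a, b]` that have the full extension in the directions outside `s`. -/
def cylinders (s : Finset (Fin d)) (a b : Lat d) : Set (Lat d × Lat d) :=
  {w | ∀ i, (i ∈ s → a i ≤ w.1 i ∧ w.1 i ≤ w.2 i ∧ w.2 i ≤ b i) ∧
    (i ∉ s → w.1 i = a i ∧ w.2 i = b i)}

/-- The maximum of `|S(W)|` over the blocks `W` in `cylinders s a b`. -/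
noncomputable def partialMax {Ω : Type*} (X : Lat d → Ω → ℝ) (s : Finset (Fin d)) (a b : Lat d) (ω : Ω) :
    ℝ≥0∞ :=
  ⨆ w ∈ cylinders s a b, ‖S X (block w.1 w.2) ω‖ₑ

theorem enorm_S_le_partialMax {Ω : Type*} (X : Lat d → Ω → ℝ) {s : Finset (Fin d)}
    {a b a' b' : Lat d} (h : (a', b') ∈ cylinders s a b) (ω : Ω) :
    ‖S X (block a' b') ω‖ₑ ≤ partialMax X s a b ω :=
  le_iSup₂ (f := fun w (_ : w ∈ cylinders s a b) => ‖S X (block w.1 w.2) ω‖ₑ) (a', b') h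

theorem measurable_partialMax {Ω : Type*} [MeasurableSpace Ω] {X : Lat d → Ω → ℝ}
    (hX : ∀ j, Measurable (X j)) (s : Finset (Fin d)) (a b : Lat d) :
    Measurable (partialMax X s a b) :=
  Measurable.biSup _ (Set.to_countable _) fun _ _ => (measurable_S hX _).enorm

theorem update_mem_cylinders {s : Finset (Fin d)} {a b : Lat d} {i : Fin d} (hi : i ∉ s)
    {u v u' v' : ℤ} {w : Lat d × Lat d}
    (hw : w ∈ cylinders s (Function.update a i u) (Function.update b i v)) :
    (Function.update w.1 i u', Function.update w.2 i v') ∈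
      cylinders s (Function.update a i u') (Function.update b i v') := by
  intro j
  rcases eq_or_ne j i with rfl | hj
  · simp [hi]
  · simpa [hj] using hw j

theorem partialMax_insert_le {Ω : Type*} (X : Lat d → Ω → ℝ) {s : Finset (Fin d)} {a b : Lat d}
    {i : Fin d} (ω : Ω) :
    partialMax X (insert i s) a b ω ≤ ⨆ u ∈ Set.Icc (a i) (b i), ⨆ v ∈ Set.Icc u (b i),
      partialMax X s (Function.update a i u) (Function.update b i v) ω := by
  refine iSup₂_le fun w hw => ?_
  have hwi := (hw i).1 (Finset.mem_insert_self i s)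
  refine le_trans ?_ (le_iSup₂_of_le (w.1 i) ⟨hwi.1, hwi.2.1.trans hwi.2.2⟩
    (le_iSup₂_of_le (w.2 i) hwi.2 le_rfl))
  refine enorm_S_le_partialMax X (fun j => ?_) ω
  rcases eq_or_ne j i with rfl | hj
  · simp [hwi.2.1]
  · simpa [hj] using hw j

/-- Induction on the set of free directions. For a new direction i, the maximum over the directions
in s, viewed as a function of the interval in direction i, satisfies the hypotheses of the
one-dimensional inequality; the cross-section supplies the factor √c. Each direction costs 2(1 -
ρ)⁻¹. -/
theorem lintegral_partialMax_le {Ω : Type*} [MeasurableSpace Ω] {P : Measure Ω}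
    {X : Lat d → Ω → ℝ} (hX : ∀ j, Measurable (X j)) {q κ ρ : ℝ} (hq : 2 < q) (hκ : 0 ≤ κ)
    (hρ0 : 0 < ρ) (hρ1 : ρ < 1) (hρ : ρ ^ q = (2 / 3 : ℝ) ^ (q / 2 - 1))
    (h : ∀ a b : Lat d,
      absMoment P (S X (block a b)) q ≤ ENNReal.ofReal ((κ * √(block a b).card) ^ q))
    (s : Finset (Fin d)) {a b : Lat d} (hab : a ≤ b) :
    ∫⁻ ω, partialMax X s a b ω ^ q ∂P ≤
      ENNReal.ofReal ((κ * (2 * (1 - ρ)⁻¹) ^ s.card * √(block a b).card) ^ q) := by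
  have hB : 0 ≤ (1 - ρ)⁻¹ := inv_nonneg.2 (by linarith)
  induction s using Finset.induction_on generalizing a b with
  | empty =>
    have h1 := h a b
    rw [absMoment_eq_lintegral_enorm _ (by linarith)] at h1
    rw [Finset.card_empty, pow_zero, mul_one]
    refine le_trans (lintegral_mono fun ω => ?_) h1
    refine ENNReal.rpow_le_rpow (iSup₂_le fun w hw => ?_) (by linarith)
    rw [show w.1 = a from funext fun i => ((hw i).2 (by simp)).1,
      show w.2 = b from funext fun i => ((hw i).2 (by simp)).2]
  | insert i s hi ih =>
    set c : ℝ := ((∏ j ∈ Finset.univ.erase i, (b j - a j).toNat : ℕ) : ℝ) with hc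
    have hc0 : 0 ≤ c := by positivity
    have hcard : ∀ u v : ℤ, u ≤ v →
        √((block (Function.update a i u) (Function.update b i v)).card : ℝ) =
          √c * √((v - u : ℤ) : ℝ) := by
      intro u v huv
      have : (((v - u).toNat : ℕ) : ℝ) = ((v - u : ℤ) : ℝ) := by
        exact_mod_cast congrArg (Int.cast (R := ℝ)) (Int.toNat_of_nonneg (sub_nonneg.2 huv))
      rw [card_block_update, Nat.cast_mul, this, mul_comm, Real.sqrt_mul hc0]
    have key := lintegral_iSup_subinterval_le (P := P)
      (F := fun u v => partialMax X s (Function.update a i u) (Function.update b i v))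
      (κ := κ * (2 * (1 - ρ)⁻¹) ^ s.card * √c) hq (by positivity) hρ0 hρ1 hρ
      (fun u v => measurable_partialMax hX _ _ _) ?_ ?_ ?_ (hab i)
    · refine le_trans (lintegral_mono fun ω =>
        ENNReal.rpow_le_rpow (partialMax_insert_le X ω) (by linarith)) (key.trans_eq ?_)
      have h2 := hcard (a i) (b i) (hab i)
      rw [Function.update_eq_self, Function.update_eq_self] at h2
      rw [h2, Finset.card_insert_of_notMem hi]
      ring_nf
    · intro u m v hum hmv ω
      refine iSup₂_le fun w hw => ?_
      have hwi := (hw i).2 hi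
      rw [Function.update_self, Function.update_self] at hwi
      rw [S_block_split X (i := i) (m := m) (by rwa [hwi.1]) (by rwa [hwi.2])]
      refine (enorm_add_le _ _).trans (add_le_add ?_ ?_)
      · refine enorm_S_le_partialMax X ?_ ω
        have := update_mem_cylinders hi hw (u' := u) (v' := m)
        rwa [← hwi.1, Function.update_eq_self, hwi.1] at this
      · refine enorm_S_le_partialMax X ?_ ω
        have := update_mem_cylinders hi hw (u' := m) (v' := v)
        rwa [← hwi.2, Function.update_eq_self, hwi.2] at this
    · intro u m v hum hmv ω
      refine iSup₂_le fun w hw => ?_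
      have hwi := (hw i).2 hi
      rw [Function.update_self, Function.update_self] at hwi
      have hsp := S_block_split X (a := Function.update w.1 i u) (b := w.2) (i := i) (m := m)
        (by simpa using hum) (by rwa [hwi.2]) ω
      rw [Function.update_idem, ← hwi.1, Function.update_eq_self] at hsp
      have hsp' := eq_sub_of_add_eq' hsp.symm
      rw [hsp', add_comm]
      refine enorm_sub_le.trans (add_le_add ?_ ?_)
      · refine enorm_S_le_partialMax X ?_ ω
        have := update_mem_cylinders hi hw (u' := u) (v' := v)
        rwa [← hwi.2, Function.update_eq_self, hwi.2] at this
      · rw [hwi.1]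
        exact enorm_S_le_partialMax X (update_mem_cylinders hi hw) ω
    · intro u v huv
      have := ih (a := Function.update a i u) (b := Function.update b i v) ?_
      · rw [hcard u v huv, ← mul_assoc] at this
        exact this
      · intro j
        rcases eq_or_ne j i with rfl | hj
        · simpa using huv
        · simpa [hj] using hab j

theorem absMoment_M_le {Ω : Type*} [MeasurableSpace Ω] {P : Measure Ω}
    (X : Lat d → Ω → ℝ) {q : ℝ} (hq : 0 ≤ q) {a b : Lat d} (hab : ∀ i, a i < b i) :
    absMoment P (M X (block a b)) q ≤ ∫⁻ ω, partialMax X Finset.univ a b ω ^ q ∂P := by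
  rw [absMoment_eq_lintegral_enorm _ hq]
  refine lintegral_mono fun ω => ENNReal.rpow_le_rpow ?_ hq
  have : Nonempty {W : Finset (Lat d) // IsBlock W ∧ W ⊆ block a b} :=
    ⟨⟨block a b, ⟨a, b, hab, rfl⟩, subset_rfl⟩⟩
  have : Finite {W : Finset (Lat d) // IsBlock W ∧ W ⊆ block a b} :=
    ((block a b).powerset.finite_toSet.subset (t := {W | IsBlock W ∧ W ⊆ block a b})
      fun W hW => by simpa using hW.2).to_subtype
  obtain ⟨⟨W, ⟨a', b', hab', rfl⟩, hW⟩, h⟩ := exists_eq_ciSup_of_finite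
    (f := fun W : {W : Finset (Lat d) // IsBlock W ∧ W ⊆ block a b} => |S X W.1 ω|)
  rw [M, ← h, Real.enorm_abs]
  refine enorm_S_le_partialMax X (fun i => ⟨fun _ => ?_, by simp⟩) ω
  -- The extreme lattice points of W are b' and a' + 1, since the intervals are open on the left;
  -- their membership gives the inclusion of coordinates.
  have h1 := mem_block.1 (hW (mem_block.2 fun i => ⟨hab' i, le_rfl⟩ : b' ∈ block a' b')) i
  have h2 := mem_block.1 (hW (mem_block.2 fun i => ⟨lt_add_one _, hab' i⟩ :
    (fun i => a' i + 1) ∈ block a' b')) i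
  exact ⟨by simpa [Int.lt_add_one_iff] using h2.1, (hab' i).le, h1.2⟩

end Blocks

/-! ### The moment inequality for block sums -/

section Moment

variable {d : ℕ} {Ω : Type*} [MeasurableSpace Ω] {P : Measure Ω} {X : Lat d → Ω → ℝ} {θ : ℕ → ℝ}

theorem abs_min_rpow_sub_le {T δ : ℝ} (hT : 0 < T) (hδ : 0 < δ) (hδ1 : δ ≤ 1) (x y : ℝ) :
    |min |x| T ^ (1 + δ) - min |y| T ^ (1 + δ)| ≤ 2 * T ^ δ * |x - y| := by
  wlog h : min |y| T ≤ min |x| T generalizing x y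
  · rw [abs_sub_comm, abs_sub_comm x]
    exact this y x (le_of_not_ge h)
  have hy : 0 ≤ min |y| T := by positivity
  have h1 := rpow_sub_rpow_le hy h (s := 1 + δ) (by linarith)
  rw [abs_of_nonneg (sub_nonneg.2 (Real.rpow_le_rpow hy h (by linarith)))]
  refine h1.trans ?_
  rw [add_sub_cancel_left]
  have h2 : min |x| T - min |y| T ≤ |x - y| := by
    refine (le_abs_self _).trans ((abs_min_sub_min_le_max _ _ _ _).trans ?_)
    simpa using abs_abs_sub_abs_le x y
  have h3 : 0 ≤ min |x| T - min |y| T := sub_nonneg.2 h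
  gcongr
  · linarith
  · exact min_le_right _ _

theorem abs_min_abs_sub_le (T x y : ℝ) : |min |x| T - min |y| T| ≤ 1 * |x - y| := by
  refine (abs_min_sub_min_le_max _ _ _ _).trans ?_
  simpa using abs_abs_sub_abs_le x y

theorem absMoment_add_le_cross {Y Z : Ω → ℝ} (hY : Measurable Y) (hZ : Measurable Z) {δ c : ℝ}
    (hδ : 0 < δ) (hδ1 : δ ≤ 1) (hc : 0 ≤ c)
    (hYZ : ∫⁻ ω, ENNReal.ofReal (|Y ω| ^ (1 + δ) * |Z ω|) ∂P ≤ ENNReal.ofReal c)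
    (hZY : ∫⁻ ω, ENNReal.ofReal (|Z ω| ^ (1 + δ) * |Y ω|) ∂P ≤ ENNReal.ofReal c) :
    absMoment P (fun ω => Y ω + Z ω) (2 + δ) ≤
      absMoment P Y (2 + δ) + absMoment P Z (2 + δ) + ENNReal.ofReal (24 * c) := by
  calc absMoment P (fun ω => Y ω + Z ω) (2 + δ)
      ≤ ∫⁻ ω, (ENNReal.ofReal (|Y ω| ^ (2 + δ)) + (ENNReal.ofReal (|Z ω| ^ (2 + δ)) +
          ENNReal.ofReal 12 * (ENNReal.ofReal (|Y ω| ^ (1 + δ) * |Z ω|) +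
            ENNReal.ofReal (|Z ω| ^ (1 + δ) * |Y ω|)))) ∂P := by
        refine lintegral_mono fun ω => ?_
        rw [← ENNReal.ofReal_add (by positivity) (by positivity),
          ← ENNReal.ofReal_mul (by norm_num), ← ENNReal.ofReal_add (by positivity) (by positivity),
          ← ENNReal.ofReal_add (by positivity) (by positivity), ← add_assoc]
        exact ENNReal.ofReal_le_ofReal (abs_add_rpow_le _ _ hδ hδ1)
    _ = absMoment P Y (2 + δ) + (absMoment P Z (2 + δ) + ENNReal.ofReal 12 *
          (∫⁻ ω, ENNReal.ofReal (|Y ω| ^ (1 + δ) * |Z ω|) ∂P +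
            ∫⁻ ω, ENNReal.ofReal (|Z ω| ^ (1 + δ) * |Y ω|) ∂P)) := by
        rw [lintegral_add_left (by fun_prop), lintegral_add_left (by fun_prop),
          lintegral_const_mul _ (by fun_prop), lintegral_add_left (by fun_prop)]
        rfl
    _ ≤ absMoment P Y (2 + δ) + (absMoment P Z (2 + δ) + ENNReal.ofReal 12 *
          (ENNReal.ofReal c + ENNReal.ofReal c)) := by gcongr
    _ = _ := by
        rw [← ENNReal.ofReal_add hc hc, ← ENNReal.ofReal_mul (by norm_num), add_assoc]
        ring_nf

theorem absMoment_le_one_add [IsProbabilityMeasure P] {Y : Ω → ℝ} {q p : ℝ} (hq : 0 ≤ q)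
    (hqp : q ≤ p) : absMoment P Y q ≤ 1 + absMoment P Y p := by
  calc absMoment P Y q ≤ ∫⁻ ω, (1 + ENNReal.ofReal (|Y ω| ^ p)) ∂P := by
        refine lintegral_mono fun ω => ?_
        rw [← ENNReal.ofReal_one, ← ENNReal.ofReal_add zero_le_one (by positivity)]
        refine ENNReal.ofReal_le_ofReal ?_
        rcases le_total |Y ω| 1 with h | h
        · have := Real.rpow_le_one (abs_nonneg (Y ω)) h hq
          linarith [(by positivity : 0 ≤ |Y ω| ^ p)]
        · linarith [Real.rpow_le_rpow_of_exponent_le h hqp]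
    _ = 1 + absMoment P Y p := by
        rw [lintegral_add_left (by fun_prop)]; simp [absMoment]

/-- Moments of the sum over two separated sets. -/
theorem IsBLDependent.absMoment_S_add_S_le [IsProbabilityMeasure P] (hX : IsBLDependent P X θ)
    (hXm : ∀ j, Measurable (X j)) (hX0 : ∀ j, ∫ ω, X j ω ∂P = 0) {p δ c₀ lam T n : ℝ} {D : ℝ≥0}
    (hδ : 0 < δ) (hδ1 : δ ≤ 1) (hp : 2 + δ < p) (hD : ∀ j, absMoment P (X j) p ≤ D)
    (hc₀ : 0 ≤ c₀) (hlam : 0 ≤ lam) (hθ : ∀ r : ℕ, 1 ≤ r → θ r ≤ c₀ * (r : ℝ) ^ (-lam))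
    (hT : 0 < T) {I J : Finset (Lat d)} (hI : I.Nonempty) (hJ : J.Nonempty) {R : ℕ} (hR : 1 ≤ R)
    (hIJ : ∀ i ∈ I, ∀ j ∈ J, R ≤ supNorm (i - j)) (hn : 0 < n) (hIn : (I.card : ℝ) ≤ n)
    (hJn : (J.card : ℝ) ≤ n) :
    absMoment P (fun ω => S X I ω + S X J ω) (2 + δ) ≤
      absMoment P (S X I) (2 + δ) + absMoment P (S X J) (2 + δ) +
        ENNReal.ofReal (24 * (2 * T ^ δ * n * (c₀ * (R : ℝ) ^ (-lam)) +
          4 * ((1 + D + c₀) * n) ^ (1 + δ / 2) + 2 * T ^ (2 + δ - p) * (n ^ p * D))) := by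
  have hD0 := D.coe_nonneg
  have hsq : ∀ V : Finset (Lat d), (V.card : ℝ) ≤ n →
      ∫ ω, S X V ω ^ 2 ∂P ≤ (1 + D + c₀) * n := by
    intro V hV
    refine (hX.integral_sq_S_le hXm hX0 hc₀ hlam hθ (v := 1 + D)
      (fun j => integral_sq_le_of_absMoment_le (hXm j) (by linarith) (hD j)) V).trans ?_
    gcongr
  have hpm : ∀ V : Finset (Lat d), (V.card : ℝ) ≤ n →
      absMoment P (S X V) p ≤ ENNReal.ofReal (n ^ p * D) := by
    intro V hV
    refine (absMoment_S_le hXm (by linarith) hD V).trans (ENNReal.ofReal_le_ofReal ?_)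
    have : 0 ≤ p := by linarith
    gcongr
  have main : ∀ A B : Finset (Lat d), A.Nonempty → B.Nonempty →
      (∀ i ∈ A, ∀ j ∈ B, R ≤ supNorm (i - j)) → (A.card : ℝ) ≤ n → (B.card : ℝ) ≤ n →
      ∫⁻ ω, ENNReal.ofReal (|S X A ω| ^ (1 + δ) * |S X B ω|) ∂P ≤
        ENNReal.ofReal (2 * T ^ δ * n * (c₀ * (R : ℝ) ^ (-lam)) +
          4 * ((1 + D + c₀) * n) ^ (1 + δ / 2) + 2 * T ^ (2 + δ - p) * (n ^ p * D)) := by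
    intro A B hA hB hAB hAn hBn
    refine lintegral_rpow_mul_le (measurable_S hXm A) (measurable_S hXm B) (hX.memLp_S A)
      (hX.memLp_S B) hδ hδ1 hp hT (by positivity) (by positivity) (hsq A hAn) (hsq B hBn)
      (hpm A hAn) (hpm B hBn) (by positivity) ?_
    refine (hX.abs_cov_comp_S_le hA hB hR hAB hc₀ hlam hθ
      (φ := fun x => min |x| T ^ (1 + δ)) (ψ := fun x => min |x| T) (A := T ^ (1 + δ)) (B := T)
      (by positivity) zero_le_one
      (abs_min_rpow_sub_le hT hδ hδ1) (abs_min_abs_sub_le T) (fun x => ?_) (fun x => ?_)).trans ?_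
    · rw [abs_of_nonneg (by positivity)]
      exact Real.rpow_le_rpow (by positivity) (min_le_right _ _) (by linarith)
    · rw [abs_of_nonneg (by positivity)]
      exact min_le_right _ _
    · rw [mul_one]
      gcongr
      exact le_trans (by exact_mod_cast min_le_left _ _) hAn
  refine absMoment_add_le_cross (measurable_S hXm I) (measurable_S hXm J) hδ hδ1 (by positivity)
    (main I J hI hJ hIJ hIn hJn) (main J I hJ hI (fun j hj i hi => ?_) hJn hIn)
  rw [supNorm_sub_comm]
  exact hIJ i hi j hj

/-- With T = n^β, `hβlam` gives T^δ ≤ l^{dβδ} ≤ l^λ, which cancels the decay R^{-λ} ≤ (εl)^{-λ},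
while `hβ` makes the total exponent of n in the tail nonpositive. -/
theorem cross_term_le {δ p β lam c₀ ε V D l n R : ℝ} (hδ : 0 < δ) (hc₀ : 0 ≤ c₀) (hlam : 0 ≤ lam)
    (hε : 0 < ε) (hV : 0 ≤ V) (hD : 0 ≤ D) (hβ0 : 0 ≤ β) (hβ : p ≤ β * (p - 2 - δ))
    (hβlam : (d : ℝ) * (β * δ) ≤ lam) (hl : 1 ≤ l) (hn1 : 1 ≤ n) (hnl : n ≤ l ^ d)
    (hR : ε * l ≤ R) :
    24 * (2 * (n ^ β) ^ δ * n * (c₀ * R ^ (-lam)) + 4 * (V * n) ^ (1 + δ / 2) +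
        2 * (n ^ β) ^ (2 + δ - p) * (n ^ p * D)) ≤
      24 * (2 * c₀ * ε ^ (-lam) + 4 * V ^ (1 + δ / 2) + 2 * D) * n ^ (1 + δ / 2) := by
  have hn : 0 < n := by linarith
  have hl0 : 0 < l := by linarith
  have h1 : n ≤ n ^ (1 + δ / 2) := Real.self_le_rpow_of_one_le hn1 (by linarith)
  have h2 : 1 ≤ n ^ (1 + δ / 2) := hn1.trans h1
  have hT : (n ^ β) ^ δ ≤ l ^ lam := by
    calc (n ^ β) ^ δ = n ^ (β * δ) := (Real.rpow_mul hn.le _ _).symm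
      _ ≤ (l ^ d) ^ (β * δ) := by gcongr
      _ = l ^ ((d : ℝ) * (β * δ)) := by rw [← Real.rpow_natCast, ← Real.rpow_mul hl0.le]
      _ ≤ l ^ lam := Real.rpow_le_rpow_of_exponent_le hl hβlam
  have hRlam : R ^ (-lam) ≤ ε ^ (-lam) * l ^ (-lam) := by
    rw [← Real.mul_rpow hε.le hl0.le]
    exact Real.rpow_le_rpow_of_nonpos (by positivity) hR (by linarith)
  have hR0 : 0 < R := lt_of_lt_of_le (by positivity) hR
  have hll : l ^ lam * l ^ (-lam) = 1 := by
    rw [← Real.rpow_add hl0, add_neg_cancel, Real.rpow_zero]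
  have e1 : 2 * (n ^ β) ^ δ * n * (c₀ * R ^ (-lam)) ≤
      2 * c₀ * ε ^ (-lam) * n ^ (1 + δ / 2) := by
    calc 2 * (n ^ β) ^ δ * n * (c₀ * R ^ (-lam))
        ≤ 2 * l ^ lam * n ^ (1 + δ / 2) * (c₀ * (ε ^ (-lam) * l ^ (-lam))) := by gcongr
      _ = 2 * c₀ * ε ^ (-lam) * n ^ (1 + δ / 2) * (l ^ lam * l ^ (-lam)) := by ring
      _ = _ := by rw [hll, mul_one]
  have e2 : (V * n) ^ (1 + δ / 2) = V ^ (1 + δ / 2) * n ^ (1 + δ / 2) := Real.mul_rpow hV hn.le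
  have e3 : (n ^ β) ^ (2 + δ - p) * n ^ p ≤ 1 := by
    rw [← Real.rpow_mul hn.le, ← Real.rpow_add hn]
    exact Real.rpow_le_one_of_one_le_of_nonpos hn1 (by linarith)
  have e4 : 2 * (n ^ β) ^ (2 + δ - p) * (n ^ p * D) ≤ 2 * D * n ^ (1 + δ / 2) := by
    calc 2 * (n ^ β) ^ (2 + δ - p) * (n ^ p * D)
        = 2 * D * ((n ^ β) ^ (2 + δ - p) * n ^ p) := by ring
      _ ≤ 2 * D * n ^ (1 + δ / 2) := by gcongr; exact e3.trans h2
  rw [e2]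
  linarith

theorem mul_sqrt_rpow {κ n δ : ℝ} (hκ : 0 ≤ κ) (hn : 0 ≤ n) :
    (κ * √n) ^ (2 + δ) = κ ^ (2 + δ) * n ^ (1 + δ / 2) := by
  rw [Real.mul_rpow hκ (by positivity), Real.sqrt_eq_rpow, ← Real.rpow_mul hn]
  ring_nf

/-- In units of κ√n: the halves contribute ρ^q to the q-th moment, and `hm` keeps the mixed part
within half of 1 - ρ^q, so Y + Z has q-norm at most σ. Minkowski adds √ε for W, and σ + √ε ≤ 1
closes the induction. -/
theorem absMoment_add_add_le {Y Z W : Ω → ℝ} (hY : Measurable Y) (hZ : Measurable Z)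
    (hW : Measurable W) {δ κ ρ σ ε m x y z n : ℝ} (hδ : 0 < δ) (hρ0 : 0 < ρ)
    (hρ : ρ ^ (2 + δ) = (2 / 3 : ℝ) ^ ((2 + δ) / 2 - 1)) (hε : 0 ≤ ε) (hσ : 0 ≤ σ)
    (hεσ : σ + √ε ≤ 1) (hσρ : (1 + ρ ^ (2 + δ)) / 2 ≤ σ ^ (2 + δ)) (hκ : 0 ≤ κ)
    (hm : 2 * m ≤ (1 - ρ ^ (2 + δ)) * κ ^ (2 + δ)) (hx : 0 ≤ x) (hy : 0 ≤ y) (hxy : x + y ≤ n)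
    (hx' : x ≤ 2 / 3 * n) (hy' : y ≤ 2 / 3 * n) (hz : z ≤ ε * n)
    (bY : absMoment P Y (2 + δ) ≤ ENNReal.ofReal ((κ * √x) ^ (2 + δ)))
    (bZ : absMoment P Z (2 + δ) ≤ ENNReal.ofReal ((κ * √y) ^ (2 + δ)))
    (bW : absMoment P W (2 + δ) ≤ ENNReal.ofReal ((κ * √z) ^ (2 + δ)))
    (bYZ : absMoment P (fun ω => Y ω + Z ω) (2 + δ) ≤ absMoment P Y (2 + δ) +
      absMoment P Z (2 + δ) + ENNReal.ofReal (m * n ^ (1 + δ / 2))) :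
    absMoment P (fun ω => Y ω + Z ω + W ω) (2 + δ) ≤ ENNReal.ofReal ((κ * √n) ^ (2 + δ)) := by
  have hn : 0 ≤ n := by linarith
  have hhalf := add_rpow_halves_le hκ hx hy hxy hx' hy' (by linarith : 2 < 2 + δ) hρ0 hρ
  have hYZ : absMoment P (fun ω => Y ω + Z ω) (2 + δ) ≤
      ENNReal.ofReal ((κ * σ * √n) ^ (2 + δ)) := by
    calc _ ≤ ENNReal.ofReal ((κ * √x) ^ (2 + δ)) + ENNReal.ofReal ((κ * √y) ^ (2 + δ)) +
          ENNReal.ofReal (m * n ^ (1 + δ / 2)) :=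
          bYZ.trans (add_le_add_left (add_le_add bY bZ) _)
      _ ≤ ENNReal.ofReal ((κ * ρ * √n) ^ (2 + δ)) + ENNReal.ofReal (m * n ^ (1 + δ / 2)) := by
          rw [← ENNReal.ofReal_add (by positivity) (by positivity)]
          gcongr
      _ ≤ ENNReal.ofReal ((κ * ρ * √n) ^ (2 + δ)) +
          ENNReal.ofReal ((1 - ρ ^ (2 + δ)) / 2 * κ ^ (2 + δ) * n ^ (1 + δ / 2)) := by
          gcongr
          linarith
      _ ≤ _ := by
          have hρ1 : ρ ^ (2 + δ) ≤ 1 := by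
            rw [hρ]
            exact Real.rpow_le_one (by norm_num) (by norm_num) (by linarith)
          have h1 : 0 ≤ (1 - ρ ^ (2 + δ)) / 2 := by linarith
          rw [← ENNReal.ofReal_add (by positivity) (by positivity),
            mul_sqrt_rpow (by positivity) hn, mul_sqrt_rpow (by positivity) hn,
            Real.mul_rpow hκ hρ0.le, Real.mul_rpow hκ hσ, ← add_mul]
          gcongr
          have hκq : 0 ≤ κ ^ (2 + δ) := by positivity
          linarith [mul_le_mul_of_nonneg_left hσρ hκq]
  have hW' : absMoment P W (2 + δ) ≤ ENNReal.ofReal ((κ * √ε * √n) ^ (2 + δ)) := by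
    refine bW.trans (ENNReal.ofReal_le_ofReal ?_)
    rw [mul_assoc, ← Real.sqrt_mul hε]
    gcongr
  refine (absMoment_add_le (hY.add hZ) hW (by linarith) (by positivity) (by positivity) hYZ
    hW').trans (ENNReal.ofReal_le_ofReal ?_)
  gcongr
  calc κ * σ * √n + κ * √ε * √n = κ * (σ + √ε) * √n := by ring
    _ ≤ κ * 1 * √n := by gcongr
    _ = _ := by ring

theorem IsBLDependent.absMoment_S_block_le [IsProbabilityMeasure P] (hX : IsBLDependent P X θ)
    (hd : 1 ≤ d) (hXm : ∀ j, Measurable (X j)) (hX0 : ∀ j, ∫ ω, X j ω ∂P = 0)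
    {p δ c₀ lam β ρ ε σ κ : ℝ} {D : ℝ≥0}
    (hδ : 0 < δ) (hδ1 : δ ≤ 1) (hp : 2 + δ < p) (hD : ∀ j, absMoment P (X j) p ≤ D)
    (hc₀ : 0 ≤ c₀) (hlam : 0 ≤ lam) (hθ : ∀ r : ℕ, 1 ≤ r → θ r ≤ c₀ * (r : ℝ) ^ (-lam))
    (hβ0 : 0 ≤ β) (hβ : p ≤ β * (p - 2 - δ)) (hβlam : (d : ℝ) * (β * δ) ≤ lam)
    (hρ0 : 0 < ρ) (hρ : ρ ^ (2 + δ) = (2 / 3 : ℝ) ^ ((2 + δ) / 2 - 1))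
    (hε : 0 < ε) (hε3 : ε ≤ 1 / 3) (hσ : 0 ≤ σ) (hεσ : σ + √ε ≤ 1)
    (hσρ : (1 + ρ ^ (2 + δ)) / 2 ≤ σ ^ (2 + δ)) (hκ : 0 ≤ κ)
    (hκ1 : 1 + ((2 : ℝ) ^ d) ^ p * D ≤ κ ^ (2 + δ))
    (hκ2 : 2 * (24 * (2 * c₀ * ε ^ (-lam) + 4 * (1 + D + c₀) ^ (1 + δ / 2) + 2 * D)) ≤
      (1 - ρ ^ (2 + δ)) * κ ^ (2 + δ)) (a b : Lat d) :
    absMoment P (S X (block a b)) (2 + δ) ≤ ENNReal.ofReal ((κ * √(block a b).card) ^ (2 + δ)) := by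
  have hD0 := D.coe_nonneg
  induction hN : (block a b).card using Nat.strong_induction_on generalizing a b with
  | _ N ih =>
  subst hN
  rcases (block a b).eq_empty_or_nonempty with hemp | hne
  · rw [hemp]
    simp [absMoment, S, Real.zero_rpow (by linarith : 2 + δ ≠ 0)]
  have hab : ∀ i, a i < b i := fun i => by
    obtain ⟨z, hz⟩ := hne
    have := mem_block.1 hz i
    omega
  have : Nonempty (Fin d) := ⟨⟨0, hd⟩⟩
  -- The longest edge is cut, so that n ≤ l^d and the separation is a definite power of the volume.
  obtain ⟨i, -, hi⟩ := Finset.exists_max_image Finset.univ (fun i => (b i - a i).toNat)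
    Finset.univ_nonempty
  set l := (b i - a i).toNat with hl
  set c := ∏ j ∈ Finset.univ.erase i, (b j - a j).toNat with hc
  have hc1 : 0 < c := Finset.prod_pos fun j _ => by have := hab j; omega
  have hcard : (block a b).card = l * c := by
    have := card_block_update a b i (a i) (b i)
    rwa [Function.update_eq_self, Function.update_eq_self] at this
  have hcard_le : (block a b).card ≤ l ^ d := by
    rw [card_block]
    exact (Finset.prod_le_pow_card _ _ _ fun j hj => hi j hj).trans_eq (by simp)
  have hl0 : 0 < l := by have := hab i; omega
  have hn1 : (1 : ℝ) ≤ (block a b).card := by exact_mod_cast hne.card_pos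
  have hp0 : 0 ≤ p := by linarith
  rcases Nat.lt_or_ge l 3 with hl3 | hl3
  -- The block has at most 2^d points, and `hκ1` covers it by the crude p-th moment bound.
  · refine (absMoment_le_one_add (by linarith) hp.le).trans ?_
    refine (add_le_add_right (absMoment_S_le hXm (by linarith) hD _) 1).trans ?_
    rw [← ENNReal.ofReal_one, ← ENNReal.ofReal_add zero_le_one (by positivity),
      mul_sqrt_rpow hκ (by positivity)]
    refine ENNReal.ofReal_le_ofReal ?_
    have h2 : ((block a b).card : ℝ) ≤ 2 ^ d := by
      exact_mod_cast hcard_le.trans (Nat.pow_le_pow_left (by omega) d)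
    calc 1 + ((block a b).card : ℝ) ^ p * D ≤ 1 + ((2 : ℝ) ^ d) ^ p * D := by gcongr
      _ ≤ κ ^ (2 + δ) := hκ1
      _ ≤ _ := le_mul_of_one_le_right (by positivity) (Real.one_le_rpow hn1 (by linarith))
  obtain ⟨n, hn⟩ : ∃ n : ℝ, n = ((block a b).card : ℝ) := ⟨_, rfl⟩
  rw [← hn] at hn1 ⊢
  have hnlc : n = l * c := by rw [hn, hcard]; push_cast; ring
  -- The gap may be empty. The two sides are nevertheless g + 1 > εl apart, which is the separation
  -- used below.
  set g := ⌊ε * l⌋₊ with hg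
  have hgl : (g : ℝ) ≤ ε * l := Nat.floor_le (by positivity)
  have hgl' : ε * l < g + 1 := Nat.lt_floor_add_one _
  have hg3 : 3 * g ≤ l := by
    have : (3 : ℝ) * g ≤ l := by
      have : ε * l ≤ 1 / 3 * l := by gcongr
      linarith
    exact_mod_cast this
  set l₁ := (l - g) / 2 with hl₁
  set l₂ := l - g - l₁ with hl₂
  set u : ℤ := a i + l₁ with hu
  set v : ℤ := u + g with hv
  have hvb : b i = v + l₂ := by omega
  set I := block a (Function.update b i u) with hIdef
  set G := block (Function.update a i u) (Function.update b i v) with hGdef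
  set J := block (Function.update a i v) b with hJdef
  have hcI : I.card = l₁ * c := by
    have := card_block_update a b i (a i) u
    rw [Function.update_eq_self] at this
    rw [this]; congr 1; omega
  have hcG : G.card = g * c := by
    rw [hGdef, card_block_update]; congr 1; omega
  have hcJ : J.card = l₂ * c := by
    have := card_block_update a b i v (b i)
    rw [Function.update_eq_self] at this
    rw [this]; congr 1; omega
  have hS : ∀ ω, S X (block a b) ω = (S X I ω + S X J ω) + S X G ω := by
    intro ω
    rw [S_block_split X (i := i) (m := u) (by omega) (by omega),
      S_block_split X (a := Function.update a i u) (b := b) (i := i) (m := v)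
        (by rw [Function.update_self]; omega) (by omega), Function.update_idem]
    ring
  have hlt : ∀ k, k < l → k * c < (block a b).card := fun k hk => by
    rw [hcard]; exact Nat.mul_lt_mul_of_pos_right hk hc1
  have bI := ih I.card (hcI ▸ hlt l₁ (by omega)) _ _ rfl
  have bJ := ih J.card (hcJ ▸ hlt l₂ (by omega)) _ _ rfl
  have bG := ih G.card (hcG ▸ hlt g (by omega)) _ _ rfl
  have hcr : (0 : ℝ) < c := by exact_mod_cast hc1
  have r1 : (I.card : ℝ) = l₁ * c := by rw [hcI]; push_cast; ring
  have r2 : (J.card : ℝ) = l₂ * c := by rw [hcJ]; push_cast; ring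
  have r3 : (G.card : ℝ) = g * c := by rw [hcG]; push_cast; ring
  have s1 : (l₁ : ℝ) ≤ 2 / 3 * l := by
    have : (3 : ℝ) * l₁ ≤ 2 * l := by exact_mod_cast (by omega : 3 * l₁ ≤ 2 * l)
    linarith
  have s2 : (l₂ : ℝ) ≤ 2 / 3 * l := by
    have : (3 : ℝ) * l₂ ≤ 2 * l := by exact_mod_cast (by omega : 3 * l₂ ≤ 2 * l)
    linarith
  have s3 : (l₁ : ℝ) + l₂ ≤ l := by exact_mod_cast (by omega : l₁ + l₂ ≤ l)
  have t1 : (I.card : ℝ) ≤ 2 / 3 * n := by rw [r1, hnlc, ← mul_assoc]; gcongr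
  have t2 : (J.card : ℝ) ≤ 2 / 3 * n := by rw [r2, hnlc, ← mul_assoc]; gcongr
  have t3 : (I.card : ℝ) + J.card ≤ n := by rw [r1, r2, hnlc, ← add_mul]; gcongr
  have t4 : (G.card : ℝ) ≤ ε * n := by rw [r3, hnlc, ← mul_assoc]; gcongr
  have hsep : ∀ z ∈ I, ∀ w ∈ J, g + 1 ≤ supNorm (z - w) := by
    intro z hz w hw
    have hz' := ((mem_block_update_right (by omega)).1 hz).2
    have hw' := ((mem_block_update_left (by omega)).1 hw).2
    have h : ((z - w) i).natAbs ≤ supNorm (z - w) :=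
      Finset.le_sup (f := fun i => ((z - w) i).natAbs) (Finset.mem_univ i)
    rw [Pi.sub_apply] at h
    omega
  have hIne : I.Nonempty := Finset.card_pos.1 (by rw [hcI]; exact Nat.mul_pos (by omega) hc1)
  have hJne : J.Nonempty := Finset.card_pos.1 (by rw [hcJ]; exact Nat.mul_pos (by omega) hc1)
  have hIJ := hX.absMoment_S_add_S_le hXm hX0 hδ hδ1 hp hD hc₀ hlam hθ
    (T := n ^ β) (n := n) (by positivity) hIne hJne (R := g + 1) (by omega) hsep (by linarith)
    (by linarith) (by linarith)
  have hcross := cross_term_le (d := d) (n := n) (l := l) (R := ((g + 1 : ℕ) : ℝ)) hδ hc₀ hlam hε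
    (V := 1 + D + c₀) (by positivity) hD0 hβ0 hβ hβlam (by exact_mod_cast hl0) hn1
    (by rw [hn]; exact_mod_cast hcard_le) (by push_cast; exact hgl'.le)
  have e : S X (block a b) = fun ω => (S X I ω + S X J ω) + S X G ω := funext hS
  rw [e]
  exact absMoment_add_add_le (measurable_S hXm I) (measurable_S hXm J) (measurable_S hXm G) hδ
    hρ0 hρ hε.le hσ hεσ hσρ hκ hκ2 (Nat.cast_nonneg _) (Nat.cast_nonneg _) t3 t1 t2 t4 bI bJ bG
    (hIJ.trans (add_le_add_right (ENNReal.ofReal_le_ofReal hcross) _))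

end Moment

/-! ### Choice of constants and conclusion -/

theorem maxConst_pos (d : ℕ) {δ : ℝ} (hδ : 0 < δ) : 0 < maxConst d δ := by
  have h : (2 : ℝ) ^ (-(δ / (4 + 2 * δ))) < 1 :=
    Real.rpow_lt_one_of_one_lt_of_neg (by norm_num) (by simp only [neg_lt_zero]; positivity)
  have : 0 < 1 - (2 : ℝ) ^ (-(δ / (4 + 2 * δ))) := by linarith
  unfold maxConst
  positivity

end BLField

theorem theorem1p1 (d : ℕ) (hd : 1 ≤ d) (p : ℝ) (hp : 2 < p) (D : ℝ≥0) (c₀ : ℝ) (hc₀ : 1 < c₀)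
    (lam : ℝ) (hlam : (d : ℝ) * BLField.psi p < lam) :
    ∃ δ : ℝ, 0 < δ ∧ ∃ C : ℝ, 1 < C ∧
      ∀ (Ω : Type*) [MeasurableSpace Ω] (P : Measure Ω) [IsProbabilityMeasure P]
        (X : (Fin d → ℤ) → Ω → ℝ) (θ : ℕ → ℝ),
        (∀ j, Measurable (X j)) →
        (∀ j, ∫ ω, X j ω ∂P = 0) →
        BLField.IsBLDependent P X θ →
        BLField.momentSup P X p ≤ (D : ℝ≥0∞) →
        (∀ r : ℕ, 1 ≤ r → θ r ≤ c₀ * (r : ℝ) ^ (-lam)) →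
        ∀ U : Finset (Fin d → ℤ), BLField.IsBlock U →
          BLField.absMoment P (BLField.S X U) (2 + δ) ≤
              ENNReal.ofReal (C * (U.card : ℝ) ^ (1 + δ / 2)) ∧
            BLField.absMoment P (BLField.M X U) (2 + δ) ≤
              ENNReal.ofReal (BLField.maxConst d δ * C * (U.card : ℝ) ^ (1 + δ / 2)) := by
  have hd0 : (0 : ℝ) < d := by exact_mod_cast hd
  have hp2 : 0 < p - 2 := by linarith
  have hlam0 : 0 < lam := (mul_pos hd0 (BLField.psi_pos hp)).trans hlam
  have hD0 := D.coe_nonneg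
  -- The bound (p - 2)/2 gives 2 + δ < p and, for β = 2p/(p - 2), the tail condition p ≤ β(p - 2 -
  -- δ). The last bound says dβδ ≤ λ.
  obtain ⟨δ, hδ, hδ1, hδp, hδlam⟩ : ∃ δ : ℝ, 0 < δ ∧ δ ≤ 1 ∧ δ ≤ (p - 2) / 2 ∧
      δ ≤ lam / (d * (2 * p / (p - 2))) := by
    refine ⟨min 1 (min ((p - 2) / 2) (lam / (d * (2 * p / (p - 2))))), ?_, min_le_left _ _,
      (min_le_right _ _).trans (min_le_left _ _), (min_le_right _ _).trans (min_le_right _ _)⟩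
    have : 0 < p := by linarith
    positivity
  set β := 2 * p / (p - 2) with hβdef
  have hβ0 : 0 < β := div_pos (by linarith) hp2
  have hβ : p ≤ β * (p - 2 - δ) := by
    calc p = β * ((p - 2) / 2) := by rw [hβdef]; field_simp
      _ ≤ _ := by gcongr; linarith
  have hβlam : (d : ℝ) * (β * δ) ≤ lam := by
    rw [le_div_iff₀ (by positivity)] at hδlam
    linarith
  obtain ⟨ρ, hρ0, hρ1, hρ⟩ := BLField.exists_contraction (q := 2 + δ) (by linarith)
  have hρq : ρ ^ (2 + δ) < 1 := Real.rpow_lt_one hρ0.le hρ1 (by linarith)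
  have hρq0 : 0 < ρ ^ (2 + δ) := by positivity
  obtain ⟨σ, hσ0, hσ1, hσρ⟩ : ∃ σ : ℝ, 0 ≤ σ ∧ σ < 1 ∧ (1 + ρ ^ (2 + δ)) / 2 ≤ σ ^ (2 + δ) := by
    refine ⟨((1 + ρ ^ (2 + δ)) / 2) ^ (2 + δ)⁻¹, by positivity, ?_, ?_⟩
    · exact Real.rpow_lt_one (by positivity) (by linarith) (by positivity)
    · rw [Real.rpow_inv_rpow (by positivity) (by positivity)]
  obtain ⟨ε, hε, hε3, hεσ⟩ : ∃ ε : ℝ, 0 < ε ∧ ε ≤ 1 / 3 ∧ σ + √ε ≤ 1 := by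
    have h1 : 0 < 1 - σ := by linarith
    refine ⟨min (1 / 3) ((1 - σ) ^ 2), by positivity, min_le_left _ _, ?_⟩
    have := Real.sqrt_le_sqrt (min_le_right (1 / 3) ((1 - σ) ^ 2))
    rw [Real.sqrt_sq h1.le] at this
    linarith
  set m : ℝ := 24 * (2 * c₀ * ε ^ (-lam) + 4 * (1 + D + c₀) ^ (1 + δ / 2) + 2 * D) with hm
  have hm0 : 0 ≤ m := by positivity
  set c : ℝ := (1 + ((2 : ℝ) ^ d) ^ p * D) + 2 * m / (1 - ρ ^ (2 + δ)) with hc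
  have h1ρ : 0 < 1 - ρ ^ (2 + δ) := by linarith
  have hc0 : 0 ≤ c := by positivity
  set κ : ℝ := c ^ (2 + δ)⁻¹ with hκdef
  have hκ : 0 ≤ κ := by positivity
  have hκc : κ ^ (2 + δ) = c := Real.rpow_inv_rpow hc0 (by positivity)
  have hκ1 : 1 + ((2 : ℝ) ^ d) ^ p * D ≤ κ ^ (2 + δ) := by
    rw [hκc]; exact le_add_of_nonneg_right (by positivity)
  have hκ2 : 2 * m ≤ (1 - ρ ^ (2 + δ)) * κ ^ (2 + δ) := by
    rw [hκc, ← div_le_iff₀' h1ρ]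
    exact le_add_of_nonneg_left (by positivity)
  set κ' : ℝ := κ * (2 * (1 - ρ)⁻¹) ^ d with hκ'def
  have hB : 0 < (1 - ρ)⁻¹ := inv_pos.2 (by linarith)
  have hκ' : 0 ≤ κ' := by positivity
  have hA := BLField.maxConst_pos d hδ
  -- The exact value of A is immaterial: A > 0 suffices, as C can absorb the quotient. The summand 2
  -- ensures C > 1.
  set C : ℝ := κ ^ (2 + δ) + κ' ^ (2 + δ) / BLField.maxConst d δ + 2 with hC
  have hκq : 0 ≤ κ ^ (2 + δ) := by positivity
  have hκq' : 0 ≤ κ' ^ (2 + δ) / BLField.maxConst d δ := by positivity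
  refine ⟨δ, hδ, C, by linarith, ?_⟩
  intro Ω _ P _ X θ hXm hX0 hX hD hθ U hU
  obtain ⟨a, b, hab, rfl⟩ := hU
  have hDj : ∀ j, BLField.absMoment P (X j) p ≤ D := fun j =>
    (le_iSup (fun j => BLField.absMoment P (X j) p) j).trans hD
  have hS := hX.absMoment_S_block_le hd hXm hX0 hδ hδ1 (by linarith) hDj (by linarith) hlam0.le hθ
    hβ0.le hβ hβlam hρ0 hρ hε hε3 hσ0 hεσ hσρ hκ hκ1 hκ2
  constructor
  · refine (hS a b).trans (ENNReal.ofReal_le_ofReal ?_)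
    rw [BLField.mul_sqrt_rpow hκ (by positivity)]
    gcongr
    linarith
  · refine (BLField.absMoment_M_le X (by linarith) hab).trans ?_
    refine (BLField.lintegral_partialMax_le hXm (by linarith) hκ hρ0 hρ1 hρ hS Finset.univ
      fun i => (hab i).le).trans (ENNReal.ofReal_le_ofReal ?_)
    rw [Finset.card_univ, Fintype.card_fin, BLField.mul_sqrt_rpow hκ' (by positivity)]
    gcongr
    calc κ' ^ (2 + δ) = BLField.maxConst d δ * (κ' ^ (2 + δ) / BLField.maxConst d δ) := by
          field_simp
      _ ≤ BLField.maxConst d δ * C := by gcongr; linarith
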